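/- Let $P$ be a Markov transition kernel on a measurable space $(\mathsf X,\mathcal B(\mathsf X))$ with stationary probability distribution $\pi$, and suppose that the chain is uniformly ergodic: there are a bounded function $M:\mathsf X\to[0,\infty)$ and a constant $t\in[0,1)$ such that $$\|P^n(x,\cdot)-\pi\|\le M(x)\,t^n\qquad\text{for all }x\in\mathsf X,\ n\ge 1,$$ where $\|\mu-\nu\|=\sup_{A\in\mathcal B(\mathsf X)}|\mu(A)-\nu(A)|$ is the total variation distance. Let $f:\mathsf X\to\mathbb R$ be a measurable function with $\mathrm E_\pi f^2=\int f^2\,d\pi<\infty$, and write $\mathrm E_\pi f=\int f\,d\pi$. Then the series in $$\sigma_f^2:=\operatorname{var}_\pi\{f(X_0)\}+2\sum_{i=1}^\infty\operatorname{cov}_\pi\{f(X_0),f(X_i)\},$$ where the subscript $\pi$ means that the chain is started from $X_0\sim\pi$, converges absolutely, $\sigma_f^2\in[0,\infty)$, and for every initial distribution $\lambda$ and every Markov chain $X=(X_0,X_1,X_2,\dots)$ with transition kernel $P$ and $X_0\sim\lambda$, the averages $\bar f_n:=n^{-1}\sum_{i=1}^n f(X_i)$ satisfy $$\sqrt n\,(\bar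 f_n-\mathrm E_\pi f)\ \xrightarrow{\ d\ }\ \mathrm N(0,\sigma_f^2)\qquad(n\to\infty),$$ where $\mathrm N(0,0)$ denotes the point mass at $0$. -/

import Mathlib

open MeasureTheory ProbabilityTheory Filter

namespace MarkovCLT

noncomputable section

/-- The transition kernel `P`, seen as the conditional law of the state at time `n + 1` given the
whole history up to time `n`: it depends on the history only through the state at time `n`. -/
def stepKernel {S : Type*} [MeasurableSpace S] (P : Kernel S S) (n : ℕ) :
    Kernel (∀ _ : Finset.Iic n, S) S :=
  P.comap (fun h => h ⟨n, Finset.mem_Iic.2 le_rfl⟩) (measurable_pi_apply _)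

instance {S : Type*} [MeasurableSpace S] (P : Kernel S S) [IsMarkovKernel P] (n : ℕ) :
    IsMarkovKernel (stepKernel P n) := by
  unfold stepKernel; infer_instance

/-- `X` is a time-homogeneous Markov chain on the probability space `(Ω, μ)`, with transition
kernel `P` and initial distribution `lam`. -/
structure IsMarkovChain {S Ω : Type*} [MeasurableSpace S] [MeasurableSpace Ω]
    (P : Kernel S S) (lam : Measure S) (X : ℕ → Ω → S) (μ : Measure Ω) : Prop where
  measurable : ∀ n, Measurable (X n)
  initial : μ.map (X 0) = lam
  /-- The conditional law of `X (n + 1)` given `(X 0, …, X n)` is `P (X n, ·)`. -/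
  markov : ∀ n, HasCondDistrib (X (n + 1)) (fun ω (i : Finset.Iic n) => X i ω) (stepKernel P n) μ

/-- The law on `S^ℕ` of the chain with transition kernel `P` and initial distribution `lam`. -/
def chainMeasure {S : Type*} [MeasurableSpace S] (P : Kernel S S) [IsMarkovKernel P]
    (lam : Measure S) : Measure (ℕ → S) :=
  Kernel.trajMeasure (X := fun _ => S) lam (stepKernel P)

/-- The total variation distance `‖μ - ν‖ = sup_A |μ(A) - ν(A)|` of two probability measures. -/
def tvDist {S : Type*} [MeasurableSpace S] (μ ν : Measure S) : ℝ :=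
  ⨆ A : {A : Set S // MeasurableSet A}, |μ.real A - ν.real A|

/-- `‖Pⁿ(x, ·) - π‖ ≤ M(x) γ(n)` for every state `x` and every `n ≥ 1`. -/
def TVBound {S : Type*} [MeasurableSpace S] (P : Kernel S S) (π : Measure S)
    (M : S → ℝ) (γ : ℕ → ℝ) : Prop :=
  ∀ n : ℕ, 1 ≤ n → ∀ x : S, tvDist ((P ^ n) x) π ≤ M x * γ n

/-- Uniform ergodicity: the total variation bound holds with a bounded nonnegative function `M`
and the rate `γ(n) = tⁿ` for some `0 ≤ t < 1`. -/
def UniformlyErgodic {S : Type*} [MeasurableSpace S] (P : Kernel S S) (π : Measure S) : Prop :=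
  ∃ (M : S → ℝ) (t : ℝ), (∀ x, 0 ≤ M x) ∧ (∃ B : ℝ, ∀ x, M x ≤ B) ∧ 0 ≤ t ∧ t < 1 ∧
    TVBound P π M (fun n => t ^ n)

/-- `cov_π {f(X_0), f(X_i)}`, for the chain started from `π`. -/
def autocov {S : Type*} [MeasurableSpace S] (P : Kernel S S) [IsMarkovKernel P]
    (π : Measure S) (f : S → ℝ) (i : ℕ) : ℝ :=
  cov[fun x : ℕ → S => f (x 0), fun x : ℕ → S => f (x i); chainMeasure P π]

/-- `σ_f² = var_π {f(X_0)} + 2 ∑_{i ≥ 1} cov_π {f(X_0), f(X_i)}`, for the chain started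
from `π`. -/
def asympVar {S : Type*} [MeasurableSpace S] (P : Kernel S S) [IsMarkovKernel P]
    (π : Measure S) (f : S → ℝ) : ℝ :=
  Var[fun x : ℕ → S => f (x 0); chainMeasure P π] + 2 * ∑' i : ℕ, autocov P π f (i + 1)

/-- `f̄_n = n⁻¹ ∑_{i=1}^n f(X_i)`. -/
def ergodicAverage {S Ω : Type*} (f : S → ℝ) (X : ℕ → Ω → S) (n : ℕ) (ω : Ω) : ℝ :=
  (n : ℝ)⁻¹ * ∑ i ∈ Finset.Icc 1 n, f (X i ω)

end

end MarkovCLT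

/-!
The proof follows the spectral perturbation method. For `θ` real let `Q_θ φ = P (e^{iθg} φ)` be the
tilted transition operator (`tiltOp`), where `g` is `f` minus its mean; the characteristic function
of `g(X₁) + ⋯ + g(Xₙ)` at `θ` is the integral of `Q_θⁿ 1` against the initial distribution.

*Bounded `f`.* By uniform ergodicity `‖Pⁿ φ - ∫ φ dπ‖` decays geometrically in the sup norm, so that
Poisson's equation `w - P w = φ` has a bounded solution whenever `∫ φ dπ = 0`
(`GeomBound.poissonSol_eq`). Solving it twice gives bounded `w₁`, `w₂` for which
`1 + iθw₁ + θ²w₂` is an eigenfunction of `Q_θ` for `1 - θ²σ²/2` up to an error `O(θ³)`, uniformly in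
the starting point; solvability of the second equation forces `σ²` to be the asymptotic variance.
With `θ = u/√n` the `n` errors add up to `O(n^{-1/2})`, since `Q_θ` is a contraction, and
`Q_θⁿ 1` tends to `exp (-u²σ²/2)` uniformly (`GeomBound.tendsto_integral_tiltOp`).

*Square integrable `f`, stationary chain.* Splitting at a level that depends on the starting point
interpolates between the sup norm and `L¹`, and shows that
`|cov (f(X_k), f(X_{k+n}))| ≤ C sⁿ ∫ f² dπ` for some `s < 1`
(`IsMarkovChain.abs_covariance_le`). Hence the series of autocovariances converges absolutely, the
asymptotic variance is the limit of those of the truncations of `f`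
(`GeomBound.tendsto_asympVar_trunc`), and `f(X₁) + ⋯ + f(Xₙ)` has variance at most
`C' n ∫ f² dπ`. Applied to `f` minus a truncation, the last bound makes the error of the truncation
small uniformly in `n`, and the limit carries over (`IsMarkovChain.tendsto_integral_exp`). That
`σ²` is nonnegative is then read off from the limit, characteristic functions being bounded by `1`.

*Arbitrary initial distribution.* Under it `f(X_i)` need not even be integrable. The
first `k` terms do not contribute to the limit, however, and what follows is a bounded function of
`X_k`, whose law is within `O(s²ᵏ)` of `π` in total variation
(`IsMarkovChain.tendsto_integral_exp_sub`). Lévy's continuity theorem concludes.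
-/

namespace MarkovCLT

open scoped Topology

/-! ### Total variation and integrals of bounded functions -/

section TotalVariation

variable {S : Type*} [MeasurableSpace S]

lemma abs_measureReal_sub_le_one (μ ν : Measure S) [IsProbabilityMeasure μ]
    [IsProbabilityMeasure ν] (A : Set S) : |μ.real A - ν.real A| ≤ 1 := by
  rw [abs_le]
  constructor <;>
    linarith [measureReal_nonneg (μ := μ) (s := A), measureReal_nonneg (μ := ν) (s := A),
      measureReal_le_one (μ := μ) (s := A), measureReal_le_one (μ := ν) (s := A)]

lemma tvDist_le_one (μ ν : Measure S) [IsProbabilityMeasure μ] [IsProbabilityMeasure ν] :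
    tvDist μ ν ≤ 1 := by
  have : Nonempty {A : Set S // MeasurableSet A} := ⟨⟨∅, MeasurableSet.empty⟩⟩
  exact ciSup_le fun A => abs_measureReal_sub_le_one μ ν A

lemma abs_measureReal_sub_le_tvDist (μ ν : Measure S) [IsProbabilityMeasure μ]
    [IsProbabilityMeasure ν] {A : Set S} (hA : MeasurableSet A) :
    |μ.real A - ν.real A| ≤ tvDist μ ν :=
  le_ciSup (f := fun A : {A : Set S // MeasurableSet A} => |μ.real A - ν.real A|)
    ⟨1, by rintro _ ⟨A, rfl⟩; exact abs_measureReal_sub_le_one μ ν A⟩ ⟨A, hA⟩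

lemma integrable_of_norm_le {E : Type*} [NormedAddCommGroup E] [MeasurableSpace E] [BorelSpace E]
    [SecondCountableTopology E] (μ : Measure S) [IsFiniteMeasure μ] {φ : S → E}
    (hφ : Measurable φ) {K : ℝ} (hK : ∀ x, ‖φ x‖ ≤ K) : Integrable φ μ :=
  Integrable.of_bound hφ.aestronglyMeasurable K (ae_of_all _ hK)

/-- By the layer cake formula, `∫ φ dμ` is the integral of `μ {t ≤ φ}` over the levels `t`. -/
lemma abs_integral_sub_le_of_nonneg {μ ν : Measure S} [IsProbabilityMeasure μ]
    [IsProbabilityMeasure ν] {δ : ℝ} (hδ : tvDist μ ν ≤ δ) {φ : S → ℝ} (hφ : Measurable φ)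
    {K : ℝ} (h0 : ∀ x, 0 ≤ φ x) (hK : ∀ x, φ x ≤ K) (hK0 : 0 ≤ K) :
    |∫ x, φ x ∂μ - ∫ x, φ x ∂ν| ≤ K * δ := by
  have hb : ∀ x, ‖φ x‖ ≤ K := fun x => by rw [Real.norm_of_nonneg (h0 x)]; exact hK x
  have hint : ∀ ρ : Measure S, [IsProbabilityMeasure ρ] →
      IntegrableOn (fun t => ρ.real {a | t ≤ φ a}) (Set.Ioc 0 K) := by
    intro ρ _
    have hanti : Antitone (fun t : ℝ => ρ.real {a | t ≤ φ a}) := fun s t hst =>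
      measureReal_mono (fun a (ha : t ≤ φ a) => hst.trans ha)
    exact (hanti.antitoneOn _ |>.integrableOn_isCompact isCompact_Icc).mono_set
      Set.Ioc_subset_Icc_self
  rw [(integrable_of_norm_le μ hφ hb).integral_eq_integral_Ioc_meas_le (ae_of_all _ h0)
      (ae_of_all _ hK),
    (integrable_of_norm_le ν hφ hb).integral_eq_integral_Ioc_meas_le (ae_of_all _ h0)
      (ae_of_all _ hK), ← integral_sub (hint μ) (hint ν)]
  have := norm_setIntegral_le_of_norm_le_const (μ := volume) (s := Set.Ioc (0 : ℝ) K)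
    (f := fun t => μ.real {a | t ≤ φ a} - ν.real {a | t ≤ φ a}) (C := δ)
    (by simp) (fun t _ => (abs_measureReal_sub_le_tvDist μ ν
      (measurableSet_le measurable_const hφ)).trans hδ)
  rw [Real.norm_eq_abs] at this
  refine this.trans (le_of_eq ?_)
  simp [measureReal_def, hK0, mul_comm]

lemma abs_integral_sub_le {μ ν : Measure S} [IsProbabilityMeasure μ]
    [IsProbabilityMeasure ν] {δ : ℝ} (hδ : tvDist μ ν ≤ δ) {φ : S → ℝ} (hφ : Measurable φ)
    {K : ℝ} (hK : ∀ x, |φ x| ≤ K) :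
    |∫ x, φ x ∂μ - ∫ x, φ x ∂ν| ≤ 2 * K * δ := by
  have hne : Nonempty S := Measure.nonempty_of_neZero μ
  have hK0 : 0 ≤ K := (abs_nonneg _).trans (hK hne.some)
  have h := abs_integral_sub_le_of_nonneg hδ (hφ.add_const K) (K := 2 * K)
    (fun x => by linarith [(abs_le.1 (hK x)).1]) (fun x => by linarith [(abs_le.1 (hK x)).2])
    (by linarith)
  rw [integral_add (integrable_of_norm_le μ hφ hK) (integrable_const _),
    integral_add (integrable_of_norm_le ν hφ hK) (integrable_const _)] at h
  simpa using h

/-- The complex version of `abs_integral_sub_le`, with a constant that is not optimal. -/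
lemma norm_integral_sub_le {μ ν : Measure S} [IsProbabilityMeasure μ]
    [IsProbabilityMeasure ν] {δ : ℝ} (hδ : tvDist μ ν ≤ δ) {φ : S → ℂ} (hφ : Measurable φ)
    {K : ℝ} (hK : ∀ x, ‖φ x‖ ≤ K) :
    ‖∫ x, φ x ∂μ - ∫ x, φ x ∂ν‖ ≤ 4 * K * δ := by
  have hre := abs_integral_sub_le hδ (Complex.measurable_re.comp hφ)
    (fun x => (Complex.abs_re_le_norm _).trans (hK x))
  have him := abs_integral_sub_le hδ (Complex.measurable_im.comp hφ)
    (fun x => (Complex.abs_im_le_norm _).trans (hK x))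
  have hμ := integrable_of_norm_le μ hφ hK
  have hν := integrable_of_norm_le ν hφ hK
  refine (Complex.norm_le_abs_re_add_abs_im _).trans ?_
  have e1 : (∫ x, φ x ∂μ - ∫ x, φ x ∂ν).re = ∫ x, (φ x).re ∂μ - ∫ x, (φ x).re ∂ν := by
    rw [Complex.sub_re]
    exact congrArg₂ _ (integral_re hμ).symm (integral_re hν).symm
  have e2 : (∫ x, φ x ∂μ - ∫ x, φ x ∂ν).im = ∫ x, (φ x).im ∂μ - ∫ x, (φ x).im ∂ν := by
    rw [Complex.sub_im]
    exact congrArg₂ _ (integral_im hμ).symm (integral_im hν).symm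
  rw [e1, e2]
  simp only [Function.comp_def] at hre him
  linarith

end TotalVariation

/-! ### Truncation -/

section Truncation

variable {S : Type*}

/-- The truncation of `f` to the interval `[-K, K]`. -/
def trunc (K : ℝ) (f : S → ℝ) (x : S) : ℝ := max (-K) (min (f x) K)

lemma measurable_trunc [MeasurableSpace S] (K : ℝ) {f : S → ℝ} (hf : Measurable f) :
    Measurable (trunc K f) :=
  measurable_const.max (hf.min measurable_const)

lemma abs_trunc_le {K : ℝ} (hK : 0 ≤ K) (f : S → ℝ) (x : S) : |trunc K f x| ≤ K := by
  rw [abs_le]; unfold trunc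
  exact ⟨le_max_left _ _, max_le (by linarith) (min_le_right _ _)⟩

lemma trunc_eq_self {K : ℝ} {f : S → ℝ} {x : S} (h : |f x| ≤ K) : trunc K f x = f x := by
  rw [abs_le] at h
  rw [trunc, min_eq_left h.2, max_eq_right h.1]

lemma abs_trunc_le_abs {K : ℝ} (hK : 0 ≤ K) (f : S → ℝ) (x : S) : |trunc K f x| ≤ |f x| := by
  rcases le_total |f x| K with h | h
  · rw [trunc_eq_self h]
  · exact (abs_trunc_le hK f x).trans h

lemma trunc_sq_le {K : ℝ} (hK : 0 ≤ K) (f : S → ℝ) (x : S) : trunc K f x ^ 2 ≤ f x ^ 2 :=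
  sq_le_sq.2 (abs_trunc_le_abs hK f x)

lemma abs_sub_trunc_le_abs {K : ℝ} (hK : 0 ≤ K) (f : S → ℝ) (x : S) :
    |f x - trunc K f x| ≤ |f x| := by
  unfold trunc
  grind

lemma sub_trunc_sq_le {K : ℝ} (hK : 0 ≤ K) (f : S → ℝ) (x : S) :
    (f x - trunc K f x) ^ 2 ≤ f x ^ 2 :=
  sq_le_sq.2 (abs_sub_trunc_le_abs hK f x)

lemma abs_sub_trunc_le_sq_div {K : ℝ} (hK : 0 < K) (f : S → ℝ) (x : S) :
    |f x - trunc K f x| ≤ f x ^ 2 / K := by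
  rcases le_total |f x| K with h | h
  · rw [trunc_eq_self h]; simp; positivity
  · refine (abs_sub_trunc_le_abs hK.le f x).trans ?_
    rw [le_div_iff₀ hK, ← sq_abs (f x)]
    nlinarith [abs_nonneg (f x)]

lemma tendsto_trunc (f : S → ℝ) (x : S) :
    Tendsto (fun n : ℕ => trunc (n : ℝ) f x) atTop (𝓝 (f x)) := by
  refine tendsto_const_nhds.congr' ?_
  obtain ⟨N, hN⟩ := exists_nat_ge |f x|
  filter_upwards [eventually_ge_atTop N] with n hn
  exact (trunc_eq_self (hN.trans (by exact_mod_cast hn))).symm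

/-- A Cauchy--Schwarz type bound for the signed measure `μ - ν`, in the additive form obtained by
splitting `g` at the level `K`; optimizing over `K` would give the bound by the square root of
`δ * (∫ g ^ 2 ∂μ + ∫ g ^ 2 ∂ν)`. -/
lemma abs_integral_sub_le_add_div [MeasurableSpace S] {μ ν : Measure S} [IsProbabilityMeasure μ]
    [IsProbabilityMeasure ν] {δ : ℝ} (hδ : tvDist μ ν ≤ δ) {g : S → ℝ} (hg : Measurable g)
    {L : ℝ} (hL : ∀ x, |g x| ≤ L) {K : ℝ} (hK : 0 < K) :
    |∫ x, g x ∂μ - ∫ x, g x ∂ν| ≤ 2 * K * δ + (∫ x, g x ^ 2 ∂μ + ∫ x, g x ^ 2 ∂ν) / K := by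
  have hgi : ∀ ρ : Measure S, [IsProbabilityMeasure ρ] → Integrable g ρ := fun ρ _ =>
    integrable_of_norm_le ρ hg hL
  have hti : ∀ ρ : Measure S, [IsProbabilityMeasure ρ] → Integrable (trunc K g) ρ := fun ρ _ =>
    integrable_of_norm_le ρ (measurable_trunc K hg) (abs_trunc_le hK.le g)
  have hsq : ∀ ρ : Measure S, [IsProbabilityMeasure ρ] → Integrable (fun x => g x ^ 2) ρ :=
    fun ρ _ => integrable_of_norm_le ρ (hg.pow_const 2) (K := L ^ 2) (fun x => by
      rw [Real.norm_eq_abs, abs_pow]; exact pow_le_pow_left₀ (abs_nonneg _) (hL x) 2)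
  have key : ∀ ρ : Measure S, [IsProbabilityMeasure ρ] →
      |∫ x, g x ∂ρ - ∫ x, trunc K g x ∂ρ| ≤ (∫ x, g x ^ 2 ∂ρ) / K := by
    intro ρ _
    rw [← integral_sub (hgi ρ) (hti ρ), ← integral_div]
    exact (abs_integral_le_integral_abs).trans (integral_mono ((hgi ρ).sub (hti ρ)).abs
      ((hsq ρ).div_const K) (fun x => abs_sub_trunc_le_sq_div hK g x))
  have h1 := key μ
  have h2 := key ν
  have h3 := abs_integral_sub_le hδ (measurable_trunc K hg) (abs_trunc_le hK.le g)
  rw [abs_le] at h1 h2 h3 ⊢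
  rw [add_div]
  constructor <;> linarith [h1.1, h1.2, h2.1, h2.2, h3.1, h3.2]

end Truncation

/-! ### The transition operator -/

section TransitionOperator

variable {S : Type*} [MeasurableSpace S] {E : Type*} [NormedAddCommGroup E] [NormedSpace ℝ E]

/-- The transition operator of a kernel, `φ ↦ ∫ φ(y) P(·, dy)`. -/
noncomputable def transOp (P : Kernel S S) (φ : S → E) (x : S) : E := ∫ y, φ y ∂P x

lemma norm_transOp_le (P : Kernel S S) [IsMarkovKernel P] {φ : S → E} {K : ℝ}
    (hK : ∀ x, ‖φ x‖ ≤ K) (x : S) : ‖transOp P φ x‖ ≤ K := by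
  simpa [transOp] using norm_integral_le_of_norm_le_const (μ := P x) (ae_of_all _ hK)

variable [MeasurableSpace E] [BorelSpace E] [SecondCountableTopology E]

lemma measurable_transOp (P : Kernel S S) [IsMarkovKernel P] {φ : S → E} (hφ : Measurable φ) :
    Measurable (transOp P φ) :=
  (hφ.stronglyMeasurable.integral_kernel (κ := P)).measurable

instance isMarkovKernel_pow (P : Kernel S S) [IsMarkovKernel P] (n : ℕ) :
    IsMarkovKernel (P ^ n) := by
  induction n with
  | zero => rw [pow_zero]; exact inferInstanceAs (IsMarkovKernel Kernel.id)
  | succ n ih => rw [pow_succ]; exact inferInstanceAs (IsMarkovKernel ((P ^ n) ∘ₖ P))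

lemma transOp_pow_zero [CompleteSpace E] (P : Kernel S S) {φ : S → E} (hφ : Measurable φ) :
    transOp (P ^ 0) φ = φ := by
  ext x
  have : (P ^ 0) x = Measure.dirac x := by rw [pow_zero]; exact Kernel.id_apply x
  rw [transOp, this, integral_dirac' _ _ hφ.stronglyMeasurable]

lemma transOp_pow_add (P : Kernel S S) [IsMarkovKernel P] {φ : S → E} (hφ : Measurable φ) {K : ℝ}
    (hK : ∀ x, ‖φ x‖ ≤ K) (m n : ℕ) :
    transOp (P ^ (m + n)) φ = transOp (P ^ n) (transOp (P ^ m) φ) := by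
  ext x
  have : P ^ (m + n) = (P ^ m) ∘ₖ (P ^ n) := Kernel.pow_add P m n
  have hi : Integrable φ (((P ^ m) ∘ₖ (P ^ n)) x) := integrable_of_norm_le _ hφ hK
  rw [transOp, this, Kernel.integral_comp hi]
  rfl

lemma transOp_pow_succ (P : Kernel S S) [IsMarkovKernel P] {φ : S → E} (hφ : Measurable φ) {K : ℝ}
    (hK : ∀ x, ‖φ x‖ ≤ K) (n : ℕ) :
    transOp (P ^ (n + 1)) φ = transOp P (transOp (P ^ n) φ) := by
  rw [transOp_pow_add P hφ hK, pow_one]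

lemma transOp_pow_succ' (P : Kernel S S) [IsMarkovKernel P] {φ : S → E} (hφ : Measurable φ) {K : ℝ}
    (hK : ∀ x, ‖φ x‖ ≤ K) (n : ℕ) :
    transOp (P ^ (n + 1)) φ = transOp (P ^ n) (transOp P φ) := by
  rw [add_comm, transOp_pow_add P hφ hK, pow_one]

lemma integral_transOp {P : Kernel S S} [IsMarkovKernel P] {π : Measure S} [IsProbabilityMeasure π]
    (hπ : P.Invariant π) {φ : S → E} (hφ : Measurable φ) {K : ℝ} (hK : ∀ x, ‖φ x‖ ≤ K) :
    ∫ x, transOp P φ x ∂π = ∫ x, φ x ∂π := by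
  have hi : Integrable φ (P ∘ₘ π) := by rw [hπ.def]; exact integrable_of_norm_le _ hφ hK
  rw [Measure.comp_eq_comp_const_apply] at hi
  have := Kernel.integral_comp hi
  rwa [← Measure.comp_eq_comp_const_apply, hπ.def, eq_comm, Kernel.const_apply] at this

lemma invariant_pow {P : Kernel S S} {π : Measure S} (hπ : P.Invariant π) (n : ℕ) :
    (P ^ n).Invariant π := by
  induction n with
  | zero => rw [pow_zero]; exact Measure.id_comp
  | succ n ih => rw [pow_succ]; exact ih.comp hπ

end TransitionOperator

/-! ### Poisson's equation -/

section Poisson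

variable {S : Type*} [MeasurableSpace S]

/-- Geometric ergodicity with explicit constants, the rate being written as a square and time `0`
being included. -/
def GeomBound (P : Kernel S S) (π : Measure S) (A s : ℝ) : Prop :=
  0 ≤ A ∧ 0 < s ∧ s < 1 ∧ ∀ n x, tvDist ((P ^ n) x) π ≤ A * (s ^ n) ^ 2

lemma UniformlyErgodic.exists_geomBound {P : Kernel S S} [IsMarkovKernel P] {π : Measure S}
    [IsProbabilityMeasure π] (h : UniformlyErgodic P π) : ∃ A s, GeomBound P π A s := by
  obtain ⟨M, t, hM, ⟨B, hB⟩, ht0, ht1, hb⟩ := h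
  have hr0 : 0 < max t (1 / 2) := lt_max_of_lt_right (by norm_num)
  have hr1 : max t (1 / 2) < 1 := max_lt ht1 (by norm_num)
  -- The maxima make the rate positive and the bound valid at time `0`.
  refine ⟨max B 1, √(max t (1 / 2)), by positivity, Real.sqrt_pos.2 hr0,
    (Real.sqrt_lt' one_pos).2 (by simpa using hr1), fun n x => ?_⟩
  rw [pow_right_comm, Real.sq_sqrt hr0.le]
  rcases Nat.eq_zero_or_pos n with rfl | hn
  · exact (tvDist_le_one ((P ^ 0) x) π).trans (by simp)
  · refine (hb n hn x).trans ?_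
    refine mul_le_mul ((hB x).trans (le_max_left _ _))
      (pow_le_pow_left₀ ht0 (le_max_left _ _) n) (by positivity) (by positivity)

variable {P : Kernel S S} {π : Measure S} {A s : ℝ}

lemma GeomBound.summable (h : GeomBound P π A s) (c : ℝ) :
    Summable (fun n : ℕ => c * (s ^ 2) ^ n) :=
  (summable_geometric_of_lt_one (sq_nonneg s)
    (pow_lt_one₀ h.2.1.le h.2.2.1 two_ne_zero)).mul_left c

variable [IsMarkovKernel P] [IsProbabilityMeasure π]

lemma GeomBound.abs_transOp_pow_le (h : GeomBound P π A s) {φ : S → ℝ} (hφ : Measurable φ)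
    {K : ℝ} (hK : ∀ x, |φ x| ≤ K) (h0 : ∫ x, φ x ∂π = 0) (n : ℕ) (x : S) :
    |transOp (P ^ n) φ x| ≤ 2 * K * A * (s ^ 2) ^ n := by
  have := abs_integral_sub_le (h.2.2.2 n x) hφ hK
  rw [h0, sub_zero] at this
  refine this.trans (le_of_eq ?_)
  rw [← pow_mul, ← pow_mul]; ring

/-- The solution `w = ∑ Pⁿ φ` of Poisson's equation `w - P w = φ`. -/
noncomputable def poissonSol (P : Kernel S S) (φ : S → ℝ) (x : S) : ℝ := ∑' n : ℕ, transOp (P ^ n) φ x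

lemma GeomBound.summable_transOp (h : GeomBound P π A s) {φ : S → ℝ} (hφ : Measurable φ)
    {K : ℝ} (hK : ∀ x, |φ x| ≤ K) (h0 : ∫ x, φ x ∂π = 0) (x : S) :
    Summable (fun n => transOp (P ^ n) φ x) :=
  Summable.of_norm_bounded (h.summable (2 * K * A)) (fun n => h.abs_transOp_pow_le hφ hK h0 n x)

lemma measurable_poissonSol (P : Kernel S S) [IsMarkovKernel P] {φ : S → ℝ} (hφ : Measurable φ) :
    Measurable (poissonSol P φ) :=
  Measurable.tsum fun n => measurable_transOp (P ^ n) hφ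

lemma GeomBound.exists_abs_poissonSol_le (h : GeomBound P π A s) {φ : S → ℝ} (hφ : Measurable φ)
    {K : ℝ} (hK : ∀ x, |φ x| ≤ K) (h0 : ∫ x, φ x ∂π = 0) :
    ∃ L, ∀ x, |poissonSol P φ x| ≤ L :=
  ⟨∑' n : ℕ, 2 * K * A * (s ^ 2) ^ n, fun x =>
    tsum_of_norm_bounded (f := fun n => transOp (P ^ n) φ x) (h.summable (2 * K * A)).hasSum
      (fun n => h.abs_transOp_pow_le hφ hK h0 n x)⟩

/-- Poisson's equation. -/
lemma GeomBound.poissonSol_eq (h : GeomBound P π A s) {φ : S → ℝ} (hφ : Measurable φ)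
    {K : ℝ} (hK : ∀ x, |φ x| ≤ K) (h0 : ∫ x, φ x ∂π = 0) (x : S) :
    poissonSol P φ x = φ x + transOp P (poissonSol P φ) x := by
  have hsum : HasSum (fun n => ∫ y, transOp (P ^ n) φ y ∂P x) (transOp P (poissonSol P φ) x) := by
    refine hasSum_integral_of_dominated_convergence (fun n _ => 2 * K * A * (s ^ 2) ^ n)
      (fun n => (measurable_transOp (P ^ n) hφ).aestronglyMeasurable)
      (fun n => ae_of_all _ fun y => h.abs_transOp_pow_le hφ hK h0 n y)
      (ae_of_all _ fun y => h.summable _) (integrable_const _)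
      (ae_of_all _ fun y => (h.summable_transOp hφ hK h0 y).hasSum)
  rw [poissonSol, (h.summable_transOp hφ hK h0 x).tsum_eq_zero_add, transOp_pow_zero P hφ,
    ← hsum.tsum_eq]
  congr 1
  refine tsum_congr fun n => ?_
  rw [transOp_pow_succ P hφ hK]
  rfl

lemma GeomBound.hasSum_integral_mul_transOp (h : GeomBound P π A s) {φ : S → ℝ}
    (hφ : Measurable φ) {K : ℝ} (hK : ∀ x, |φ x| ≤ K) (h0 : ∫ x, φ x ∂π = 0) :
    HasSum (fun n => ∫ x, φ x * transOp (P ^ n) φ x ∂π) (∫ x, φ x * poissonSol P φ x ∂π) := by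
  have hK0 : 0 ≤ K := (abs_nonneg _).trans (hK (Measure.nonempty_of_neZero π).some)
  refine hasSum_integral_of_dominated_convergence (fun n _ => K * (2 * K * A) * (s ^ 2) ^ n)
      (fun n => (hφ.mul (measurable_transOp (P ^ n) hφ)).aestronglyMeasurable)
      (fun n => ae_of_all _ fun y => ?_)
      (ae_of_all _ fun y => h.summable _) (integrable_const _)
      (ae_of_all _ fun y => (h.summable_transOp hφ hK h0 y).hasSum.mul_left _)
  rw [norm_mul, mul_assoc]
  exact mul_le_mul (hK y) (h.abs_transOp_pow_le hφ hK h0 n y) (norm_nonneg _) hK0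

end Poisson

/-! ### The tilted transition operator -/

section Tilt

variable {S : Type*} [MeasurableSpace S]

/-- The tilted transition operator `φ ↦ P (e^{iθf} φ)`. The `n`-th iterate applied to the constant
`1` is, as a function of the starting point, the characteristic function at `θ` of
`f(X₁) + ⋯ + f(Xₙ)`. -/
noncomputable def tiltOp (P : Kernel S S) (f : S → ℝ) (θ : ℝ) (φ : S → ℂ) : S → ℂ :=
  transOp P (fun y => Complex.exp ((θ * f y : ℝ) * Complex.I) * φ y)

lemma norm_tiltOp_le (P : Kernel S S) [IsMarkovKernel P] (f : S → ℝ) (θ : ℝ) {φ : S → ℂ} {K : ℝ}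
    (hK : ∀ x, ‖φ x‖ ≤ K) (x : S) : ‖tiltOp P f θ φ x‖ ≤ K :=
  norm_transOp_le P (fun y => by
    rw [norm_mul, Complex.norm_exp_ofReal_mul_I, one_mul]; exact hK y) x

lemma norm_tiltOp_iterate_le (P : Kernel S S) [IsMarkovKernel P] (f : S → ℝ) (θ : ℝ) {φ : S → ℂ}
    {K : ℝ} (hK : ∀ x, ‖φ x‖ ≤ K) (n : ℕ) (x : S) : ‖(tiltOp P f θ)^[n] φ x‖ ≤ K := by
  induction n generalizing x with
  | zero => exact hK x
  | succ n ih => rw [Function.iterate_succ_apply']; exact norm_tiltOp_le P f θ ih x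

variable (P : Kernel S S) [IsMarkovKernel P] {f : S → ℝ} (hf : Measurable f) (θ : ℝ)

include hf

lemma measurable_exp_mul {φ : S → ℂ} (hφ : Measurable φ) :
    Measurable (fun y => Complex.exp ((θ * f y : ℝ) * Complex.I) * φ y) := by
  fun_prop

lemma measurable_tiltOp {φ : S → ℂ} (hφ : Measurable φ) : Measurable (tiltOp P f θ φ) :=
  measurable_transOp P (measurable_exp_mul hf θ hφ)

lemma measurable_tiltOp_iterate {φ : S → ℂ} (hφ : Measurable φ) (n : ℕ) :
    Measurable ((tiltOp P f θ)^[n] φ) := by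
  induction n with
  | zero => exact hφ
  | succ n ih => rw [Function.iterate_succ_apply']; exact measurable_tiltOp P hf θ ih

lemma tiltOp_sub {φ ψ : S → ℂ} (hφ : Measurable φ) (hψ : Measurable ψ) {K L : ℝ}
    (hK : ∀ x, ‖φ x‖ ≤ K) (hL : ∀ x, ‖ψ x‖ ≤ L) (x : S) :
    tiltOp P f θ (fun y => φ y - ψ y) x = tiltOp P f θ φ x - tiltOp P f θ ψ x := by
  unfold tiltOp transOp
  rw [← integral_sub]
  · simp_rw [mul_sub]
  · exact integrable_of_norm_le (K := K) _ (measurable_exp_mul hf θ hφ) (fun y => by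
      rw [norm_mul, Complex.norm_exp_ofReal_mul_I, one_mul]; exact hK y)
  · exact integrable_of_norm_le (K := L) _ (measurable_exp_mul hf θ hψ) (fun y => by
      rw [norm_mul, Complex.norm_exp_ofReal_mul_I, one_mul]; exact hL y)

lemma norm_tiltOp_sub_le {φ ψ : S → ℂ} (hφ : Measurable φ) (hψ : Measurable ψ) {K L C : ℝ}
    (hK : ∀ x, ‖φ x‖ ≤ K) (hL : ∀ x, ‖ψ x‖ ≤ L) (hC : ∀ x, ‖φ x - ψ x‖ ≤ C) (x : S) :
    ‖tiltOp P f θ φ x - tiltOp P f θ ψ x‖ ≤ C := by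
  rw [← tiltOp_sub P hf θ hφ hψ hK hL]
  exact norm_tiltOp_le P f θ hC x

lemma norm_tiltOp_iterate_sub_le {φ ψ : S → ℂ} (hφ : Measurable φ) (hψ : Measurable ψ) {K L C : ℝ}
    (hK : ∀ x, ‖φ x‖ ≤ K) (hL : ∀ x, ‖ψ x‖ ≤ L) (hC : ∀ x, ‖φ x - ψ x‖ ≤ C) (n : ℕ) (x : S) :
    ‖(tiltOp P f θ)^[n] φ x - (tiltOp P f θ)^[n] ψ x‖ ≤ C := by
  induction n generalizing x with
  | zero => exact hC x
  | succ n ih =>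
    rw [Function.iterate_succ_apply', Function.iterate_succ_apply']
    exact norm_tiltOp_sub_le P hf θ (measurable_tiltOp_iterate P hf θ hφ n)
      (measurable_tiltOp_iterate P hf θ hψ n) (norm_tiltOp_iterate_le P f θ hK n)
      (norm_tiltOp_iterate_le P f θ hL n) ih x

/-- Iterating an approximate eigenfunction: the errors add up, since the operator is a
contraction. -/
lemma norm_tiltOp_iterate_sub_pow_le {w : S → ℂ} (hw : Measurable w) {L η R : ℝ} {ρ : ℂ}
    (hL : ∀ x, ‖w x‖ ≤ L) (hR : 1 ≤ R) (hρ : ‖ρ‖ ≤ R)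
    (h : ∀ x, ‖tiltOp P f θ w x - ρ * w x‖ ≤ η) (n : ℕ) (x : S) :
    ‖(tiltOp P f θ)^[n] w x - ρ ^ n * w x‖ ≤ n * R ^ n * η := by
  have hη : 0 ≤ η := (norm_nonneg _).trans (h x)
  induction n generalizing x with
  | zero => simp
  | succ n ih =>
    have hscale : tiltOp P f θ (fun y => ρ ^ n * w y) x = ρ ^ n * tiltOp P f θ w x := by
      unfold tiltOp transOp
      rw [← integral_const_mul]
      congr 1; ext y; ring
    have h1 : ‖(tiltOp P f θ)^[n + 1] w x - ρ ^ n * tiltOp P f θ w x‖ ≤ n * R ^ n * η := by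
      rw [Function.iterate_succ_apply', ← hscale]
      exact norm_tiltOp_sub_le P hf θ (measurable_tiltOp_iterate P hf θ hw n) (hw.const_mul _)
        (norm_tiltOp_iterate_le P f θ hL n) (L := ‖ρ ^ n‖ * L) (fun y => by
          rw [norm_mul]; exact mul_le_mul_of_nonneg_left (hL y) (norm_nonneg _)) ih x
    have h2 : ‖ρ ^ n * tiltOp P f θ w x - ρ ^ (n + 1) * w x‖ ≤ R ^ n * η := by
      have : ρ ^ n * tiltOp P f θ w x - ρ ^ (n + 1) * w x
          = ρ ^ n * (tiltOp P f θ w x - ρ * w x) := by ring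
      rw [this, norm_mul, norm_pow]
      exact mul_le_mul (pow_le_pow_left₀ (norm_nonneg _) hρ n) (h x) (norm_nonneg _)
        (by positivity)
    calc ‖(tiltOp P f θ)^[n + 1] w x - ρ ^ (n + 1) * w x‖
        ≤ n * R ^ n * η + R ^ n * η := (norm_sub_le_norm_sub_add_norm_sub _ _ _).trans
          (add_le_add h1 h2)
      _ = (n + 1 : ℕ) * R ^ n * η := by push_cast; ring
      _ ≤ (n + 1 : ℕ) * R ^ (n + 1) * η := by
        gcongr
        · exact Nat.le_succ n

end Tilt

/-! ### Second-order expansion of the leading eigenvalue -/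

section Perturbation

lemma norm_exp_sub_taylor_two_le (x : ℝ) :
    ‖Complex.exp (x * Complex.I) - (1 + x * Complex.I - x ^ 2 / 2)‖ ≤ 4 * |x| ^ 3 := by
  have hI : ‖(x : ℂ) * Complex.I‖ = |x| := by simp
  rcases le_total |x| 1 with h | h
  · have := Complex.exp_bound (x := x * Complex.I) (by rw [hI]; exact h) (n := 3) (by norm_num)
    rw [hI] at this
    have e : ∑ m ∈ Finset.range 3, ((x : ℂ) * Complex.I) ^ m / (m.factorial : ℂ)
        = 1 + x * Complex.I - x ^ 2 / 2 := by
      simp [Finset.sum_range_succ, Nat.factorial, mul_pow]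
      ring
    rw [e] at this
    refine this.trans ?_
    rw [mul_comm]
    refine mul_le_mul_of_nonneg_right ?_ (by positivity)
    norm_num [Nat.factorial]
  · have h1 : ‖(1 : ℂ) + x * Complex.I - x ^ 2 / 2‖ ≤ 1 + |x| + |x| ^ 2 / 2 := by
      refine (norm_sub_le _ _).trans (add_le_add ((norm_add_le _ _).trans ?_) ?_)
      · rw [hI]; simp
      · simp
    have h2 := norm_sub_le (Complex.exp (x * Complex.I)) (1 + x * Complex.I - x ^ 2 / 2)
    rw [Complex.norm_exp_ofReal_mul_I] at h2
    nlinarith [pow_le_pow_right₀ h (show 1 ≤ 3 by norm_num),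
      pow_le_pow_right₀ h (show 2 ≤ 3 by norm_num), one_le_pow₀ h (n := 3)]

/-- The product of `e^{iθa}` and `1 + iθb + θ²c`, expanded to second order in `θ`. -/
lemma norm_exp_mul_sub_expansion_le {K a b c θ : ℝ} (hK : 1 ≤ K) (ha : |a| ≤ K) (hb : |b| ≤ K)
    (hc : |c| ≤ K) (hθ : |θ| ≤ 1) :
    ‖Complex.exp ((θ * a : ℝ) * Complex.I) * (1 + θ * b * Complex.I + θ ^ 2 * c)
      - (1 + θ * (a + b) * Complex.I + θ ^ 2 * (c - a * b - a ^ 2 / 2))‖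
      ≤ 14 * K ^ 4 * |θ| ^ 3 := by
  have hw : ‖(1 : ℂ) + θ * b * Complex.I + θ ^ 2 * c‖ ≤ 3 * K := by
    refine (norm_add₃_le).trans ?_
    simp only [norm_mul, norm_pow, Complex.norm_real, Complex.norm_I, Real.norm_eq_abs, norm_one,
      mul_one]
    nlinarith [abs_nonneg θ, abs_nonneg b, abs_nonneg c, mul_le_mul hθ hb (abs_nonneg _) zero_le_one,
      mul_le_mul (pow_le_one₀ (abs_nonneg θ) hθ (n := 2)) hc (abs_nonneg _) zero_le_one]
  have he := norm_exp_sub_taylor_two_le (θ * a)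
  set e := Complex.exp ((θ * a : ℝ) * Complex.I)
  have hsplit : e * (1 + θ * b * Complex.I + θ ^ 2 * c)
      - (1 + θ * (a + b) * Complex.I + θ ^ 2 * (c - a * b - a ^ 2 / 2))
      = (e - (1 + (θ * a : ℝ) * Complex.I - ((θ * a : ℝ) : ℂ) ^ 2 / 2))
          * (1 + θ * b * Complex.I + θ ^ 2 * c)
        + (θ : ℂ) ^ 3 * ((a * c - a ^ 2 * b / 2) * Complex.I - θ * a ^ 2 * c / 2) := by
    push_cast
    linear_combination ((θ : ℂ) ^ 2 * a * b) * Complex.I_sq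
  have hrem : ‖((a : ℂ) * c - a ^ 2 * b / 2) * Complex.I - θ * a ^ 2 * c / 2‖ ≤ 2 * K ^ 4 := by
    have h1 : ‖((a : ℂ) * c - a ^ 2 * b / 2) * Complex.I - θ * a ^ 2 * c / 2‖
        ≤ |a| * |c| + |a| ^ 2 * |b| / 2 + |θ| * |a| ^ 2 * |c| / 2 := by
      refine (norm_sub_le _ _).trans (add_le_add ?_ (by simp))
      rw [norm_mul, Complex.norm_I, mul_one]
      exact (norm_sub_le _ _).trans (by simp)
    have h2 : |a| * |c| ≤ K ^ 4 := by
      calc |a| * |c| ≤ K * K := by gcongr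
        _ = K ^ 2 := by ring
        _ ≤ K ^ 4 := pow_le_pow_right₀ hK (by norm_num)
    have h3 : |a| ^ 2 * |b| ≤ K ^ 4 := by
      calc |a| ^ 2 * |b| ≤ K ^ 2 * K := by gcongr
        _ = K ^ 3 := by ring
        _ ≤ K ^ 4 := pow_le_pow_right₀ hK (by norm_num)
    have h4 : |θ| * |a| ^ 2 * |c| ≤ K ^ 4 := by
      calc |θ| * |a| ^ 2 * |c| ≤ 1 * K ^ 2 * K := by gcongr
        _ = K ^ 3 := by ring
        _ ≤ K ^ 4 := pow_le_pow_right₀ hK (by norm_num)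
    linarith
  have ha3 : |a| ^ 3 ≤ K ^ 3 := pow_le_pow_left₀ (abs_nonneg a) ha 3
  rw [hsplit]
  refine (norm_add_le _ _).trans ?_
  rw [norm_mul, norm_mul, norm_pow, Complex.norm_real, Real.norm_eq_abs]
  calc _ ≤ 4 * |θ * a| ^ 3 * (3 * K) + |θ| ^ 3 * (2 * K ^ 4) := by gcongr
    _ = |θ| ^ 3 * (12 * |a| ^ 3 * K + 2 * K ^ 4) := by rw [abs_mul]; ring
    _ ≤ |θ| ^ 3 * (12 * K ^ 3 * K + 2 * K ^ 4) := by gcongr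
    _ = 14 * K ^ 4 * |θ| ^ 3 := by ring

variable {S : Type*} [MeasurableSpace S]

/-- If `w₁` and `w₂` solve the first and second order equations, then `1 + iθw₁ + θ²w₂` is an
eigenfunction of the tilted operator for the eigenvalue `1 - θ²v/2`, up to an error of order
`θ³`. -/
lemma norm_tiltOp_expansion_sub_le (P : Kernel S S) [IsMarkovKernel P] {f w₁ w₂ : S → ℝ}
    (hf : Measurable f) (hw₁ : Measurable w₁) (hw₂ : Measurable w₂) {K v : ℝ} (hK : 1 ≤ K)
    (hfK : ∀ x, |f x| ≤ K) (hw₁K : ∀ x, |w₁ x| ≤ K) (hw₂K : ∀ x, |w₂ x| ≤ K)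
    (h₁ : ∀ x, transOp P (fun y => f y + w₁ y) x = w₁ x)
    (h₂ : ∀ x, transOp P (fun y => w₂ y - f y * w₁ y - f y ^ 2 / 2) x = w₂ x - v / 2)
    {θ : ℝ} (hθ : |θ| ≤ 1) (x : S) :
    ‖tiltOp P f θ (fun y => 1 + θ * w₁ y * Complex.I + θ ^ 2 * w₂ y) x
      - (1 - θ ^ 2 * v / 2 : ℝ) * (1 + θ * w₁ x * Complex.I + θ ^ 2 * w₂ x)‖
      ≤ (14 * K ^ 4 + |v| * K) * |θ| ^ 3 := by
  have hi₁ : Integrable (fun y => f y + w₁ y) (P x) :=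
    integrable_of_norm_le _ (hf.add hw₁) (K := K + K)
      (fun y => (abs_add_le _ _).trans (add_le_add (hfK y) (hw₁K y)))
  have hi₂ : Integrable (fun y => w₂ y - f y * w₁ y - f y ^ 2 / 2) (P x) := by
    refine integrable_of_norm_le _ (by fun_prop) (K := K + K * K + K ^ 2 / 2) (fun y => ?_)
    refine (norm_sub_le _ _).trans (add_le_add ((norm_sub_le _ _).trans
      (add_le_add (hw₂K y) ?_)) ?_)
    · rw [norm_mul]
      exact mul_le_mul (hfK y) (hw₁K y) (norm_nonneg _) (by linarith)
    · rw [norm_div, norm_pow, Real.norm_eq_abs, Real.norm_two]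
      have := pow_le_pow_left₀ (abs_nonneg _) (hfK y) 2
      linarith
  have hmain : transOp P (fun y => (1 : ℂ) + θ * (f y + w₁ y) * Complex.I
      + θ ^ 2 * (w₂ y - f y * w₁ y - f y ^ 2 / 2)) x
      = 1 + θ * w₁ x * Complex.I + θ ^ 2 * (w₂ x - v / 2) := by
    have e : ∀ y, (1 : ℂ) + θ * (f y + w₁ y) * Complex.I
        + θ ^ 2 * (w₂ y - f y * w₁ y - f y ^ 2 / 2)
        = 1 + ((f y + w₁ y : ℝ) : ℂ) * (θ * Complex.I)
          + ((w₂ y - f y * w₁ y - f y ^ 2 / 2 : ℝ) : ℂ) * θ ^ 2 := by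
      intro y; push_cast; ring
    unfold transOp
    simp_rw [e]
    rw [integral_add ((integrable_const _).add (hi₁.ofReal.mul_const _)) (hi₂.ofReal.mul_const _),
      integral_add (integrable_const _) (hi₁.ofReal.mul_const _), integral_mul_const,
      integral_mul_const, integral_complex_ofReal, integral_complex_ofReal]
    have e1 : ∫ y, (f y + w₁ y) ∂P x = w₁ x := h₁ x
    have e2 : ∫ y, (w₂ y - f y * w₁ y - f y ^ 2 / 2) ∂P x = w₂ x - v / 2 := h₂ x
    rw [e1, e2]
    simp
    ring
  have hbd : ∀ y, ‖(1 : ℂ) + θ * w₁ y * Complex.I + θ ^ 2 * w₂ y‖ ≤ 3 * K := by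
    intro y
    refine (norm_add₃_le).trans ?_
    simp only [norm_mul, norm_pow, Complex.norm_real, Complex.norm_I, Real.norm_eq_abs, norm_one,
      mul_one]
    nlinarith [mul_le_mul hθ (hw₁K y) (abs_nonneg _) zero_le_one,
      mul_le_mul (pow_le_one₀ (abs_nonneg θ) hθ (n := 2)) (hw₂K y) (abs_nonneg _) zero_le_one]
  have hia : Integrable (fun y => Complex.exp ((θ * f y : ℝ) * Complex.I)
      * (1 + θ * w₁ y * Complex.I + θ ^ 2 * w₂ y)) (P x) :=
    integrable_of_norm_le (K := 3 * K) _ (by fun_prop) (fun y => by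
      rw [norm_mul, Complex.norm_exp_ofReal_mul_I, one_mul]; exact hbd y)
  have hib : Integrable (fun y => (1 : ℂ) + θ * (f y + w₁ y) * Complex.I
      + θ ^ 2 * (w₂ y - f y * w₁ y - f y ^ 2 / 2)) (P x) := by
    have e : ∀ y, (1 : ℂ) + θ * (f y + w₁ y) * Complex.I
        + θ ^ 2 * (w₂ y - f y * w₁ y - f y ^ 2 / 2)
        = 1 + ((f y + w₁ y : ℝ) : ℂ) * (θ * Complex.I)
          + ((w₂ y - f y * w₁ y - f y ^ 2 / 2 : ℝ) : ℂ) * θ ^ 2 := by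
      intro y; push_cast; ring
    simp_rw [e]
    exact ((integrable_const _).add (hi₁.ofReal.mul_const _)).add (hi₂.ofReal.mul_const _)
  have herr : ‖tiltOp P f θ (fun y => 1 + θ * w₁ y * Complex.I + θ ^ 2 * w₂ y) x
      - (1 + θ * w₁ x * Complex.I + θ ^ 2 * (w₂ x - v / 2))‖ ≤ 14 * K ^ 4 * |θ| ^ 3 := by
    rw [← hmain]
    unfold tiltOp transOp
    rw [← integral_sub hia hib]
    simpa using norm_integral_le_of_norm_le_const (μ := P x) (ae_of_all _ fun y =>
      norm_exp_mul_sub_expansion_le hK (hfK y) (hw₁K y) (hw₂K y) hθ)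
  have hcubic : ‖(1 + θ * w₁ x * Complex.I + θ ^ 2 * (w₂ x - v / 2))
      - (1 - θ ^ 2 * v / 2 : ℝ) * (1 + θ * w₁ x * Complex.I + θ ^ 2 * w₂ x)‖
      ≤ |v| * K * |θ| ^ 3 := by
    have e : (1 + θ * w₁ x * Complex.I + θ ^ 2 * (w₂ x - v / 2))
      - (1 - θ ^ 2 * v / 2 : ℝ) * (1 + θ * w₁ x * Complex.I + θ ^ 2 * w₂ x)
      = (θ : ℂ) ^ 3 * (v / 2) * (w₁ x * Complex.I + θ * w₂ x) := by
      push_cast; ring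
    have h3 : ‖(w₁ x : ℂ) * Complex.I + θ * w₂ x‖ ≤ 2 * K := by
      refine (norm_add_le _ _).trans ?_
      simp only [norm_mul, Complex.norm_real, Complex.norm_I, Real.norm_eq_abs, mul_one]
      nlinarith [hw₁K x, mul_le_mul hθ (hw₂K x) (abs_nonneg _) zero_le_one]
    rw [e, norm_mul, norm_mul, norm_pow, Complex.norm_real, Real.norm_eq_abs]
    have h4 : ‖(v : ℂ) / 2‖ = |v| / 2 := by simp
    rw [h4]
    calc _ ≤ |θ| ^ 3 * (|v| / 2) * (2 * K) := by gcongr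
      _ = _ := by ring
  refine (norm_sub_le_norm_sub_add_norm_sub _ _ _).trans ((add_le_add herr hcubic).trans ?_)
  rw [add_mul]

end Perturbation

/-! ### The limit for bounded functions -/

section BoundedLimit

variable {S : Type*} [MeasurableSpace S] {P : Kernel S S} [IsMarkovKernel P] {π : Measure S}
  [IsProbabilityMeasure π] {A s : ℝ}

/-- The first and second order equations are both Poisson equations; the asymptotic variance is
the value of `v` for which the second one is solvable. -/
lemma GeomBound.exists_corrector (h : GeomBound P π A s) (hπ : P.Invariant π) {f : S → ℝ}
    (hf : Measurable f) {K : ℝ} (hK : ∀ x, |f x| ≤ K) (h0 : ∫ x, f x ∂π = 0) {v : ℝ}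
    (hv : v = ∫ x, f x ^ 2 ∂π + 2 * ∫ x, f x * (poissonSol P f x - f x) ∂π) :
    ∃ (w₁ w₂ : S → ℝ) (L : ℝ), Measurable w₁ ∧ Measurable w₂ ∧ 1 ≤ L ∧ (∀ x, |f x| ≤ L) ∧
      (∀ x, |w₁ x| ≤ L) ∧ (∀ x, |w₂ x| ≤ L) ∧
      (∀ x, transOp P (fun y => f y + w₁ y) x = w₁ x) ∧
      ∀ x, transOp P (fun y => w₂ y - f y * w₁ y - f y ^ 2 / 2) x = w₂ x - v / 2 := by
  obtain ⟨L₁, hL₁⟩ := h.exists_abs_poissonSol_le hf hK h0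
  set w₁ : S → ℝ := fun x => poissonSol P f x - f x with hw₁def
  have hw₁ : Measurable w₁ := (measurable_poissonSol P hf).sub hf
  have hw₁b : ∀ x, |w₁ x| ≤ L₁ + K := fun x =>
    (abs_sub _ _).trans (add_le_add (hL₁ x) (hK x))
  set g : S → ℝ := fun y => f y * w₁ y + f y ^ 2 / 2 with hg
  have hgm : Measurable g := by fun_prop
  have hgb : ∀ x, |g x| ≤ K * (L₁ + K) + K ^ 2 / 2 := by
    intro x
    refine (abs_add_le _ _).trans (add_le_add ?_ ?_)
    · rw [abs_mul]
      exact mul_le_mul (hK x) (hw₁b x) (abs_nonneg _) ((abs_nonneg _).trans (hK x))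
    · rw [abs_div, abs_pow, abs_two]
      have := pow_le_pow_left₀ (abs_nonneg _) (hK x) 2
      linarith
  have hφm : Measurable (fun x => v / 2 - transOp P g x) :=
    measurable_const.sub (measurable_transOp P hgm)
  have hφb : ∀ x, |v / 2 - transOp P g x| ≤ |v / 2| + (K * (L₁ + K) + K ^ 2 / 2) := fun x =>
    (abs_sub _ _).trans (add_le_add le_rfl (norm_transOp_le (φ := g) P hgb x))
  have hφ0 : ∫ x, (v / 2 - transOp P g x) ∂π = 0 := by
    rw [integral_sub (integrable_const _)
      (integrable_of_norm_le _ (measurable_transOp P hgm) (norm_transOp_le P hgb)),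
      integral_transOp hπ hgm hgb]
    have e : ∫ x, g x ∂π = ∫ x, f x * w₁ x ∂π + (∫ x, f x ^ 2 ∂π) / 2 := by
      rw [hg, integral_add, integral_div]
      · refine integrable_of_norm_le _ (by fun_prop) (K := K * (L₁ + K)) (fun x => ?_)
        rw [norm_mul]
        exact mul_le_mul (hK x) (hw₁b x) (norm_nonneg _) ((abs_nonneg _).trans (hK x))
      · refine (integrable_of_norm_le _ (by fun_prop) (K := K ^ 2) (fun x => ?_)).div_const _
        rw [norm_pow]
        exact pow_le_pow_left₀ (abs_nonneg _) (hK x) 2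
    rw [e, hv]
    simp
    ring
  obtain ⟨L₂, hL₂⟩ := h.exists_abs_poissonSol_le hφm hφb hφ0
  set w₂ := poissonSol P (fun x => v / 2 - transOp P g x)
  have hw₂ : Measurable w₂ := measurable_poissonSol P hφm
  refine ⟨w₁, w₂, max 1 (max K (max (L₁ + K) L₂)), hw₁, hw₂, le_max_left _ _,
    fun x => (hK x).trans (by simp), fun x => (hw₁b x).trans (by simp),
    fun x => (hL₂ x).trans (by simp), fun x => ?_, fun x => ?_⟩
  · have e : (fun y => f y + w₁ y) = poissonSol P f := by ext y; simp [hw₁def]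
    rw [e, hw₁def]
    simp only
    rw [h.poissonSol_eq hf hK h0 x]; ring
  · have h2 := h.poissonSol_eq hφm hφb hφ0 x
    have e : transOp P (fun y => w₂ y - f y * w₁ y - f y ^ 2 / 2) x
        = transOp P w₂ x - transOp P g x := by
      unfold transOp
      rw [← integral_sub (integrable_of_norm_le _ hw₂ hL₂) (integrable_of_norm_le _ hgm hgb)]
      congr 1; ext y; simp only [hg]; ring
    rw [e]
    change w₂ x = v / 2 - transOp P g x + transOp P w₂ x at h2
    linarith

/-- For bounded centered `f`, the characteristic function of `n^{-1/2} (f(X₁) + ⋯ + f(Xₙ))` tends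
to that of the centered Gaussian distribution of variance `v`, for every initial distribution. -/
theorem GeomBound.tendsto_integral_tiltOp (h : GeomBound P π A s) (hπ : P.Invariant π) {f : S → ℝ}
    (hf : Measurable f) {K : ℝ} (hK : ∀ x, |f x| ≤ K) (h0 : ∫ x, f x ∂π = 0) {v : ℝ}
    (hv : v = ∫ x, f x ^ 2 ∂π + 2 * ∫ x, f x * (poissonSol P f x - f x) ∂π)
    (lam : Measure S) [IsProbabilityMeasure lam] (u : ℝ) :
    Tendsto (fun n : ℕ => ∫ x, (tiltOp P f ((√n)⁻¹ * u))^[n] (fun _ => 1) x ∂lam) atTop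
      (𝓝 (Complex.exp (-(u ^ 2 * v / 2 : ℝ)))) := by
  obtain ⟨w₁, w₂, L, hw₁, hw₂, hL, hfL, hw₁L, hw₂L, h₁, h₂⟩ := h.exists_corrector hπ hf hK h0 hv
  set c := u ^ 2 * v / 2 with hc
  set D := 4 * L + 14 * L ^ 4 + |v| * L
  have hρ : Tendsto (fun n : ℕ => (((1 + (-c) / n) ^ n : ℝ) : ℂ)) atTop
      (𝓝 (Complex.exp (-(c : ℝ)))) := by
    have := (Complex.continuous_ofReal.tendsto _).comp (Real.tendsto_one_add_div_pow_exp (-c))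
    rw [Complex.ofReal_exp, Complex.ofReal_neg] at this
    exact this
  have hθ0 : Tendsto (fun n : ℕ => |(√n)⁻¹ * u|) atTop (𝓝 0) := by
    have : Tendsto (fun n : ℕ => (√n)⁻¹ * u) atTop (𝓝 0) := by
      rw [← zero_mul u]
      exact .mul_const u (tendsto_inv_atTop_zero.comp <| Real.tendsto_sqrt_atTop.comp <|
        tendsto_natCast_atTop_atTop)
    simpa using this.abs
  set B : ℕ → ℝ := fun n => |(√n)⁻¹ * u| * (2 * L + Real.exp |c| * (2 * L)
    + u ^ 2 * Real.exp |c| * (14 * L ^ 4 + |v| * L))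
  have hB : Tendsto B atTop (𝓝 0) := by
    have := hθ0.mul_const (2 * L + Real.exp |c| * (2 * L)
      + u ^ 2 * Real.exp |c| * (14 * L ^ 4 + |v| * L))
    rwa [zero_mul] at this
  refine tendsto_of_tendsto_of_dist hρ ?_
  refine squeeze_zero' (Eventually.of_forall fun _ => dist_nonneg) ?_ hB
  filter_upwards [eventually_ge_atTop 1, hθ0.eventually (Iic_mem_nhds zero_lt_one)] with n hn hθ1
  have hθ1 : |(√n)⁻¹ * u| ≤ 1 := hθ1
  have hn0 : (0 : ℝ) < n := by exact_mod_cast hn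
  set θ := (√n)⁻¹ * u with hθ
  have hθsq : θ ^ 2 = u ^ 2 / n := by
    rw [hθ, mul_pow, inv_pow, Real.sq_sqrt hn0.le]; field_simp
  have hρeq : 1 - θ ^ 2 * v / 2 = 1 + (-c) / n := by rw [hθsq, hc]; field_simp; ring
  set w : S → ℂ := fun y => 1 + θ * w₁ y * Complex.I + θ ^ 2 * w₂ y with hw
  have hwm : Measurable w := by fun_prop
  have hw1 : ∀ y, ‖1 - w y‖ ≤ |θ| * (2 * L) := by
    intro y
    have e : 1 - w y = -(θ * (w₁ y * Complex.I + θ * w₂ y)) := by simp only [hw]; ring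
    have h3 : ‖(w₁ y : ℂ) * Complex.I + θ * w₂ y‖ ≤ 2 * L := by
      refine (norm_add_le _ _).trans ?_
      simp only [norm_mul, Complex.norm_real, Complex.norm_I, Real.norm_eq_abs, mul_one]
      nlinarith [hw₁L y, mul_le_mul hθ1 (hw₂L y) (abs_nonneg _) zero_le_one]
    rw [e, norm_neg, norm_mul, Complex.norm_real, Real.norm_eq_abs]
    gcongr
  have hwb : ∀ y, ‖w y‖ ≤ 1 + |θ| * (2 * L) := by
    intro y
    have := norm_sub_le (1 : ℂ) (1 - w y)
    rw [sub_sub_cancel, norm_one] at this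
    linarith [hw1 y]
  have hR : (1 + |c| / n) ^ n ≤ Real.exp |c| := by
    calc (1 + |c| / n) ^ n ≤ (Real.exp (|c| / n)) ^ n := by
          gcongr
          linarith [Real.add_one_le_exp (|c| / n)]
      _ = Real.exp |c| := by
          rw [← Real.exp_nat_mul]; congr 1; field_simp
  have hR1 : (1 : ℝ) ≤ 1 + |c| / n := by
    have : 0 ≤ |c| / n := by positivity
    linarith
  have hρR : ‖((1 - θ ^ 2 * v / 2 : ℝ) : ℂ)‖ ≤ 1 + |c| / n := by
    rw [hρeq, Complex.norm_real, Real.norm_eq_abs]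
    refine (abs_add_le _ _).trans (le_of_eq ?_)
    rw [abs_one, abs_div, abs_neg, Nat.abs_cast]
  have hpow : ‖(((1 + (-c) / n) ^ n : ℝ) : ℂ)‖ ≤ Real.exp |c| := by
    rw [← hρeq, Complex.ofReal_pow, norm_pow]
    exact (pow_le_pow_left₀ (norm_nonneg _) hρR n).trans hR
  have hpt : ∀ x, ‖(tiltOp P f θ)^[n] (fun _ => 1) x - (((1 + (-c) / n) ^ n : ℝ) : ℂ)‖ ≤ B n := by
    intro x
    have e1 := norm_tiltOp_iterate_sub_le P hf θ (measurable_const (a := (1 : ℂ))) hwm (K := 1)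
      (fun _ => by simp) hwb hw1 n x
    have e2 := norm_tiltOp_iterate_sub_pow_le P hf θ hwm hwb hR1 hρR
      (norm_tiltOp_expansion_sub_le P hf hw₁ hw₂ hL hfL hw₁L hw₂L h₁ h₂ hθ1) n x
    rw [← Complex.ofReal_pow, hρeq] at e2
    have e3 : ‖(((1 + (-c) / n) ^ n : ℝ) : ℂ) * w x - (((1 + (-c) / n) ^ n : ℝ) : ℂ)‖
        ≤ Real.exp |c| * (|θ| * (2 * L)) := by
      have : (((1 + (-c) / n) ^ n : ℝ) : ℂ) * w x - (((1 + (-c) / n) ^ n : ℝ) : ℂ)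
        = -((((1 + (-c) / n) ^ n : ℝ) : ℂ) * (1 - w x)) := by ring
      rw [this, norm_neg, norm_mul]
      exact mul_le_mul hpow (hw1 x) (norm_nonneg _) (Real.exp_pos _).le
    -- The `n` errors of order `|θ|³` add up to order `|θ|`, because `n θ² = u²`.
    have hcube : (n : ℝ) * (1 + |c| / n) ^ n * ((14 * L ^ 4 + |v| * L) * |θ| ^ 3)
        ≤ |θ| * (u ^ 2 * Real.exp |c| * (14 * L ^ 4 + |v| * L)) := by
      have : (n : ℝ) * |θ| ^ 3 = |θ| * u ^ 2 := by
        rw [pow_succ, sq_abs, hθsq]; field_simp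
      calc _ = (1 + |c| / n) ^ n * (14 * L ^ 4 + |v| * L) * ((n : ℝ) * |θ| ^ 3) := by ring
        _ ≤ Real.exp |c| * (14 * L ^ 4 + |v| * L) * ((n : ℝ) * |θ| ^ 3) := by gcongr
        _ = _ := by rw [this]; ring
    calc _ ≤ |θ| * (2 * L) + |θ| * (u ^ 2 * Real.exp |c| * (14 * L ^ 4 + |v| * L))
          + Real.exp |c| * (|θ| * (2 * L)) :=
          (norm_sub_le_norm_sub_add_norm_sub _ _ _).trans (add_le_add
            ((norm_sub_le_norm_sub_add_norm_sub _ _ _).trans (add_le_add e1 (e2.trans hcube))) e3)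
      _ = B n := by simp only [B]; ring
  have hint : Integrable ((tiltOp P f θ)^[n] (fun _ => 1)) lam :=
    integrable_of_norm_le _ (measurable_tiltOp_iterate P hf θ measurable_const n)
      (norm_tiltOp_iterate_le P f θ (K := 1) (fun _ => by simp) n)
  rw [dist_comm, dist_eq_norm]
  have e : ∫ x, (tiltOp P f θ)^[n] (fun _ => 1) x ∂lam - (((1 + (-c) / n) ^ n : ℝ) : ℂ)
      = ∫ x, ((tiltOp P f θ)^[n] (fun _ => 1) x - (((1 + (-c) / n) ^ n : ℝ) : ℂ)) ∂lam := by
    rw [integral_sub hint (integrable_const _)]; simp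
  rw [e]
  simpa using norm_integral_le_of_norm_le_const (μ := lam) (ae_of_all _ hpt)

end BoundedLimit

/-! ### Markov chains -/

section Chain

variable {S : Type*} [MeasurableSpace S] {P : Kernel S S} [IsMarkovKernel P] {lam : Measure S}
  {Ω : Type*} [MeasurableSpace Ω] {μ : Measure Ω} [IsProbabilityMeasure μ] {X : ℕ → Ω → S}

/-- The Markov property, tested against a bounded function of the history times a bounded function of
the next state. -/
lemma IsMarkovChain.integral_history_mul {𝕜 : Type*} [RCLike 𝕜] (hX : IsMarkovChain P lam X μ)
    (n : ℕ) {G : (∀ _ : Finset.Iic n, S) → 𝕜} (hG : Measurable G) {C : ℝ} (hC : ∀ h, ‖G h‖ ≤ C)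
    {b : S → 𝕜} (hb : Measurable b) {K : ℝ} (hK : ∀ x, ‖b x‖ ≤ K) :
    ∫ ω, G (fun i : Finset.Iic n => X i ω) * b (X (n + 1) ω) ∂μ
      = ∫ ω, G (fun i : Finset.Iic n => X i ω) * transOp P b (X n ω) ∂μ := by
  have hC0 : 0 ≤ C :=
    (norm_nonneg _).trans (hC (fun i => X i (Measure.nonempty_of_neZero μ).some))
  have hist : Measurable (fun ω (i : Finset.Iic n) => X i ω) :=
    measurable_pi_lambda _ fun i => hX.measurable i
  have hm : Measurable (fun p : (∀ _ : Finset.Iic n, S) × S => G p.1 * b p.2) := by fun_prop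
  have hmap := (hX.markov n).map_eq
  have : IsProbabilityMeasure (μ.map fun ω (i : Finset.Iic n) => X i ω) :=
    Measure.isProbabilityMeasure_map hist.aemeasurable
  calc ∫ ω, G (fun i : Finset.Iic n => X i ω) * b (X (n + 1) ω) ∂μ
      = ∫ p, G p.1 * b p.2 ∂(μ.map fun ω => ((fun i : Finset.Iic n => X i ω), X (n + 1) ω)) := by
        rw [integral_map (hist.prodMk (hX.measurable _)).aemeasurable hm.aestronglyMeasurable]
    _ = ∫ h, G h * transOp P b (h ⟨n, Finset.mem_Iic.2 le_rfl⟩)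
          ∂(μ.map fun ω (i : Finset.Iic n) => X i ω) := by
        rw [hmap, Measure.integral_compProd]
        · simp_rw [integral_const_mul]
          rfl
        · refine integrable_of_norm_le _ hm (K := C * K) (fun p => ?_)
          rw [norm_mul]
          exact mul_le_mul (hC _) (hK _) (norm_nonneg _) hC0
    _ = ∫ ω, G (fun i : Finset.Iic n => X i ω) * transOp P b (X n ω) ∂μ := by
        rw [integral_map hist.aemeasurable]
        exact (hG.mul ((measurable_transOp P hb).comp
          (measurable_pi_apply _))).aestronglyMeasurable

lemma IsMarkovChain.integral_mul {𝕜 : Type*} [RCLike 𝕜] (hX : IsMarkovChain P lam X μ) (k n : ℕ)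
    {a b : S → 𝕜} (ha : Measurable a) {C : ℝ} (hC : ∀ x, ‖a x‖ ≤ C)
    (hb : Measurable b) {K : ℝ} (hK : ∀ x, ‖b x‖ ≤ K) :
    ∫ ω, a (X k ω) * b (X (k + n) ω) ∂μ = ∫ ω, a (X k ω) * transOp (P ^ n) b (X k ω) ∂μ := by
  induction n generalizing b with
  | zero => rw [transOp_pow_zero P hb]; rfl
  | succ n ih =>
    have := hX.integral_history_mul (k + n)
      (G := fun h => a (h ⟨k, Finset.mem_Iic.2 (Nat.le_add_right k n)⟩))
      (ha.comp (measurable_pi_apply _)) (fun h => hC _) hb hK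
    rw [transOp_pow_succ' P hb hK, ← ih (measurable_transOp P hb) (norm_transOp_le P hK)]
    exact this

/-- The conditional characteristic function of `f(X_{k+1}) + ⋯ + f(X_{k+m})` given `X_k` is the
`m`-th iterate of the tilted operator. -/
lemma IsMarkovChain.integral_exp_mul (hX : IsMarkovChain P lam X μ) {f : S → ℝ}
    (hf : Measurable f) (θ : ℝ) (k m : ℕ) {φ : S → ℂ} (hφ : Measurable φ) {K : ℝ}
    (hK : ∀ x, ‖φ x‖ ≤ K) :
    ∫ ω, Complex.exp ((θ * ∑ j ∈ Finset.range m, f (X (k + j + 1) ω) : ℝ) * Complex.I)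
        * φ (X (k + m) ω) ∂μ
      = ∫ ω, (tiltOp P f θ)^[m] φ (X k ω) ∂μ := by
  induction m generalizing φ with
  | zero => simp
  | succ m ih =>
    rw [Function.iterate_succ_apply, ← ih (measurable_tiltOp P hf θ hφ) (norm_tiltOp_le P f θ hK)]
    have := hX.integral_history_mul (k + m)
      (G := fun h => Complex.exp ((θ * ∑ j : Fin m,
        f (h ⟨k + j + 1, Finset.mem_Iic.2 (by omega)⟩) : ℝ) * Complex.I))
      (by fun_prop) (C := 1) (fun h => (Complex.norm_exp_ofReal_mul_I _).le)
      (measurable_exp_mul hf θ hφ) (K := K) (fun y => by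
        rw [norm_mul, Complex.norm_exp_ofReal_mul_I, one_mul]; exact hK y)
    simp only [Finset.sum_range]
    refine Eq.trans (integral_congr_ae (ae_of_all _ fun ω => ?_)) this
    simp only
    rw [← mul_assoc, ← Complex.exp_add, Fin.sum_univ_castSucc]
    congr 2
    push_cast
    simp only [Fin.val_castSucc]
    ring

lemma IsMarkovChain.map_succ (hX : IsMarkovChain P lam X μ) (n : ℕ) :
    μ.map (X (n + 1)) = P ∘ₘ (μ.map (X n)) := by
  have h : HasCondDistrib (X (n + 1)) (X n) P μ :=
    HasCondDistrib.comp_right (f := fun h : (∀ _ : Finset.Iic n, S) =>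
      h ⟨n, Finset.mem_Iic.2 le_rfl⟩) (hf := measurable_pi_apply _) (hX.markov n)
  have := congrArg Measure.snd h.map_eq
  rwa [Measure.snd_compProd, Measure.snd_map_prodMk (hX.measurable n)] at this

lemma IsMarkovChain.map_eq {π : Measure S} (hπ : P.Invariant π) (hX : IsMarkovChain P π X μ)
    (n : ℕ) : μ.map (X n) = π := by
  induction n with
  | zero => exact hX.initial
  | succ n ih => rw [hX.map_succ, ih]; exact hπ

lemma isMarkovChain_chainMeasure (P : Kernel S S) [IsMarkovKernel P] (lam : Measure S)
    [IsProbabilityMeasure lam] :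
    IsMarkovChain P lam (fun n (x : ℕ → S) => x n) (chainMeasure P lam) where
  measurable n := measurable_pi_apply n
  initial := by
    have h0 : (chainMeasure P lam).map (Preorder.frestrictLe (π := fun _ => S) 0)
        = lam.map (MeasurableEquiv.piUnique fun _ : Finset.Iic 0 => S).symm := by
      rw [chainMeasure, Kernel.trajMeasure, Measure.map_comp _ _ (by fun_prop),
        Kernel.traj_map_frestrictLe, Kernel.partialTraj_self, Measure.id_comp]
    have h1 := congrArg (Measure.map fun h : (∀ _ : Finset.Iic 0, S) =>
      h ⟨0, Finset.mem_Iic.2 le_rfl⟩) h0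
    rw [Measure.map_map (by fun_prop) (by fun_prop),
      Measure.map_map (by fun_prop) (by fun_prop)] at h1
    exact h1.trans Measure.map_id
  markov n := by
    refine ⟨by fun_prop, ?_⟩
    exact (Kernel.map_frestrictLe_trajMeasure_compProd_eq_map_trajMeasure (X := fun _ => S)
      (κ := stepKernel P) (μ₀ := lam) (a := n)).symm

end Chain

/-! ### Decay of correlations -/

section Covariance

variable {S : Type*} [MeasurableSpace S]

lemma memLp_trunc {π : Measure S} [IsFiniteMeasure π] {f : S → ℝ} (hf : Measurable f) {K : ℝ}
    (hK : 0 ≤ K) : MemLp (trunc K f) 2 π :=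
  MemLp.of_bound (measurable_trunc K hf).aestronglyMeasurable K
    (ae_of_all _ fun x => abs_trunc_le hK f x)

lemma tendsto_integral_trunc {π : Measure S} {f : S → ℝ} (hf : Measurable f)
    (hfi : Integrable f π) :
    Tendsto (fun K : ℕ => ∫ x, trunc (K : ℝ) f x ∂π) atTop (𝓝 (∫ x, f x ∂π)) :=
  tendsto_integral_of_dominated_convergence (fun x => |f x|)
    (fun _ => (measurable_trunc _ hf).aestronglyMeasurable) hfi.abs
    (fun K => ae_of_all _ fun x => abs_trunc_le_abs K.cast_nonneg f x)
    (ae_of_all _ fun x => tendsto_trunc f x)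

lemma tendsto_integral_sub_trunc_sq {π : Measure S} {f : S → ℝ} (hf : Measurable f)
    (hf2 : Integrable (fun x => f x ^ 2) π) :
    Tendsto (fun K : ℕ => ∫ x, (f x - trunc (K : ℝ) f x) ^ 2 ∂π) atTop (𝓝 0) := by
  have := tendsto_integral_of_dominated_convergence (μ := π)
    (F := fun (K : ℕ) x => (f x - trunc (K : ℝ) f x) ^ 2) (f := fun _ => 0) (fun x => f x ^ 2)
    (fun _ => ((hf.sub (measurable_trunc _ hf)).pow_const 2).aestronglyMeasurable) hf2
    (fun K => ae_of_all _ fun x => by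
      rw [Real.norm_of_nonneg (sq_nonneg _)]; exact sub_trunc_sq_le K.cast_nonneg f x)
    (ae_of_all _ fun x => by
      have := (tendsto_const_nhds (x := f x)).sub (tendsto_trunc f x)
      simpa using this.pow 2)
  simpa using this

variable {P : Kernel S S} {π : Measure S} {A s : ℝ}

lemma GeomBound.summable_pow_mul (h : GeomBound P π A s) (c : ℝ) :
    Summable (fun i : ℕ => s ^ (i + 1) * c) :=
  ((summable_nat_add_iff 1).2 (summable_geometric_of_lt_one h.2.1.le h.2.2.1)).mul_right c

variable [IsMarkovKernel P] {Ω : Type*} [MeasurableSpace Ω] {μ : Measure Ω} [IsProbabilityMeasure μ] {X : ℕ → Ω → S}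

lemma IsMarkovChain.measurePreserving (hX : IsMarkovChain P π X μ) (hπ : P.Invariant π) (n : ℕ) :
    MeasurePreserving (X n) μ π :=
  ⟨hX.measurable n, hX.map_eq hπ n⟩

lemma IsMarkovChain.integral_comp_eq (hX : IsMarkovChain P π X μ) (hπ : P.Invariant π) (n : ℕ)
    {E : Type*} [NormedAddCommGroup E] [NormedSpace ℝ E] [MeasurableSpace E] [BorelSpace E]
    [SecondCountableTopology E] {φ : S → E} (hφ : Measurable φ) :
    ∫ ω, φ (X n ω) ∂μ = ∫ x, φ x ∂π := by
  rw [← hX.map_eq hπ n, integral_map (hX.measurable n).aemeasurable hφ.aestronglyMeasurable]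

lemma IsMarkovChain.memLp_comp (hX : IsMarkovChain P π X μ) (hπ : P.Invariant π) (n : ℕ)
    {f : S → ℝ} (hf : MemLp f 2 π) : MemLp (fun ω => f (X n ω)) 2 μ :=
  hf.comp_measurePreserving (hX.measurePreserving hπ n)

lemma IsMarkovChain.covariance_eq [IsFiniteMeasure π] (hX : IsMarkovChain P π X μ) (hπ : P.Invariant π)
    {f : S → ℝ} (hf : Measurable f) (hf2 : MemLp f 2 π) (i j : ℕ) :
    cov[fun ω => f (X i ω), fun ω => f (X j ω); μ]
      = ∫ ω, f (X i ω) * f (X j ω) ∂μ - (∫ x, f x ∂π) ^ 2 := by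
  rw [covariance_eq_sub (hX.memLp_comp hπ i hf2) (hX.memLp_comp hπ j hf2),
    hX.integral_comp_eq hπ i hf, hX.integral_comp_eq hπ j hf, sq]
  rfl

variable [IsProbabilityMeasure π]

/-- The truncation level in `abs_integral_sub_le_add_div` is taken to be `|f(x)| / sⁿ` at the starting
point `x`, so that both terms are of order `sⁿ` and the bound is quadratic in `f`. -/
lemma GeomBound.abs_mul_transOp_sub_le (h : GeomBound P π A s) {f : S → ℝ} (hf : Measurable f)
    {K : ℝ} (hK : ∀ x, |f x| ≤ K) (n : ℕ) (x : S) :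
    |f x * (transOp (P ^ n) f x - ∫ y, f y ∂π)|
      ≤ s ^ n * (2 * A * f x ^ 2 + (transOp (P ^ n) (fun y => f y ^ 2) x + ∫ y, f y ^ 2 ∂π)) := by
  have hs : 0 < s ^ n := pow_pos h.2.1 n
  have hA := h.1
  have hc : 0 ≤ transOp (P ^ n) (fun y => f y ^ 2) x + ∫ y, f y ^ 2 ∂π :=
    add_nonneg (integral_nonneg fun _ => sq_nonneg _) (integral_nonneg fun _ => sq_nonneg _)
  rcases eq_or_ne (f x) 0 with h0 | h0
  · rw [h0, zero_mul, abs_zero]; positivity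
  · have hpos : 0 < |f x| := abs_pos.2 h0
    have := abs_integral_sub_le_add_div (h.2.2.2 n x) hf hK (K := |f x| / s ^ n) (by positivity)
    rw [abs_mul]
    refine (mul_le_mul_of_nonneg_left this (abs_nonneg _)).trans (le_of_eq ?_)
    rw [← sq_abs (f x)]
    change |f x| * (2 * (|f x| / s ^ n) * (A * (s ^ n) ^ 2) +
      (transOp (P ^ n) (fun y => f y ^ 2) x + ∫ y, f y ^ 2 ∂π) / (|f x| / s ^ n)) = _
    field_simp

lemma IsMarkovChain.abs_covariance_le_of_bounded (hX : IsMarkovChain P π X μ)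
    (h : GeomBound P π A s) (hπ : P.Invariant π) {f : S → ℝ} (hf : Measurable f) {K : ℝ}
    (hK : ∀ x, |f x| ≤ K) (k n : ℕ) :
    |cov[fun ω => f (X k ω), fun ω => f (X (k + n) ω); μ]|
      ≤ s ^ n * ((2 * A + 2) * ∫ x, f x ^ 2 ∂π) := by
  have hf2 : MemLp f 2 π := MemLp.of_bound hf.aestronglyMeasurable K (ae_of_all _ hK)
  have hsqm : Measurable (fun x => f x ^ 2) := hf.pow_const 2
  have hsqb : ∀ x, ‖f x ^ 2‖ ≤ K ^ 2 := fun x => by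
    rw [norm_pow]; exact pow_le_pow_left₀ (abs_nonneg _) (hK x) 2
  have hsqi : Integrable (fun x => f x ^ 2) π := integrable_of_norm_le _ hsqm hsqb
  have hTm := measurable_transOp (P ^ n) hf
  have hTb := norm_transOp_le (P ^ n) (φ := f) hK
  have hK0 : 0 ≤ K := (abs_nonneg _).trans (hK (Measure.nonempty_of_neZero π).some)
  have hfT : Integrable (fun x => f x * transOp (P ^ n) f x) π :=
    integrable_of_norm_le _ (hf.mul hTm) (K := K * K) (fun x => by
      rw [norm_mul]; exact mul_le_mul (hK x) (hTb x) (norm_nonneg _) hK0)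
  have hfi : Integrable f π := integrable_of_norm_le _ hf hK
  have hTi : Integrable (transOp (P ^ n) fun y => f y ^ 2) π :=
    integrable_of_norm_le _ (measurable_transOp (P ^ n) hsqm) (norm_transOp_le (P ^ n) hsqb)
  rw [hX.covariance_eq hπ hf hf2, hX.integral_mul k n hf hK hf hK,
    hX.integral_comp_eq hπ k (φ := fun x => f x * transOp (P ^ n) f x) (hf.mul hTm)]
  have e : ∫ x, f x * transOp (P ^ n) f x ∂π - (∫ x, f x ∂π) ^ 2
      = ∫ x, f x * (transOp (P ^ n) f x - ∫ y, f y ∂π) ∂π := by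
    simp_rw [mul_sub]
    rw [integral_sub hfT (hfi.mul_const _), integral_mul_const, sq]
  have hb : Integrable (fun x => s ^ n *
      (2 * A * f x ^ 2 + (transOp (P ^ n) (fun y => f y ^ 2) x + ∫ y, f y ^ 2 ∂π))) π :=
    ((hsqi.const_mul _).add (hTi.add (integrable_const _))).const_mul _
  rw [e]
  refine (abs_integral_le_integral_abs).trans ((integral_mono ?_ hb
    (fun x => h.abs_mul_transOp_sub_le hf hK n x)).trans (le_of_eq ?_))
  · have := (hfT.sub (hfi.mul_const (∫ y, f y ∂π))).abs
    refine this.congr (ae_of_all _ fun x => ?_)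
    simp [mul_sub]
  · rw [integral_const_mul, integral_add (f := fun x => 2 * A * f x ^ 2)
        (g := fun x => transOp (P ^ n) (fun y => f y ^ 2) x + ∫ y, f y ^ 2 ∂π)
        (hsqi.const_mul _) (hTi.add (integrable_const _)),
      integral_add hTi (integrable_const _), integral_const_mul,
      integral_transOp (invariant_pow hπ n) hsqm hsqb]
    simp only [integral_const, probReal_univ, one_smul]
    ring

lemma IsMarkovChain.tendsto_covariance_trunc (hX : IsMarkovChain P π X μ) (hπ : P.Invariant π)
    {f : S → ℝ} (hf : Measurable f) (hf2 : MemLp f 2 π) (i j : ℕ) :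
    Tendsto (fun K : ℕ =>
        cov[fun ω => trunc (K : ℝ) f (X i ω), fun ω => trunc (K : ℝ) f (X j ω); μ]) atTop
      (𝓝 cov[fun ω => f (X i ω), fun ω => f (X j ω); μ]) := by
  have e : ∀ K : ℕ,
      cov[fun ω => trunc (K : ℝ) f (X i ω), fun ω => trunc (K : ℝ) f (X j ω); μ]
        = ∫ ω, trunc (K : ℝ) f (X i ω) * trunc (K : ℝ) f (X j ω) ∂μ
          - (∫ x, trunc (K : ℝ) f x ∂π) ^ 2 := fun K =>
    hX.covariance_eq hπ (measurable_trunc _ hf) (memLp_trunc hf K.cast_nonneg) i j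
  simp_rw [e]
  rw [hX.covariance_eq hπ hf hf2]
  refine Tendsto.sub ?_ ((tendsto_integral_trunc hf (hf2.integrable one_le_two)).pow 2)
  refine tendsto_integral_of_dominated_convergence (fun ω => |f (X i ω) * f (X j ω)|)
    (fun K => (((measurable_trunc _ hf).comp (hX.measurable i)).mul
      ((measurable_trunc _ hf).comp (hX.measurable j))).aestronglyMeasurable)
    ((hX.memLp_comp hπ i hf2).integrable_mul (hX.memLp_comp hπ j hf2)).abs
    (fun K => ae_of_all _ fun ω => ?_)
    (ae_of_all _ fun ω => (tendsto_trunc f _).mul (tendsto_trunc f _))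
  rw [norm_mul, abs_mul]
  exact mul_le_mul (abs_trunc_le_abs K.cast_nonneg f _) (abs_trunc_le_abs K.cast_nonneg f _)
    (norm_nonneg _) (abs_nonneg _)

lemma IsMarkovChain.abs_covariance_trunc_le (hX : IsMarkovChain P π X μ)
    (h : GeomBound P π A s) (hπ : P.Invariant π) {f : S → ℝ} (hf : Measurable f)
    (hf2 : MemLp f 2 π) (k n : ℕ) (K : ℕ) :
    |cov[fun ω => trunc (K : ℝ) f (X k ω), fun ω => trunc (K : ℝ) f (X (k + n) ω); μ]|
      ≤ s ^ n * ((2 * A + 2) * ∫ x, f x ^ 2 ∂π) := by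
  have hA := h.1
  have hs := h.2.1
  refine (hX.abs_covariance_le_of_bounded h hπ (measurable_trunc K hf)
    (abs_trunc_le K.cast_nonneg f) k n).trans ?_
  gcongr ?_ * (?_ * ?_)
  exact integral_mono (memLp_trunc hf K.cast_nonneg).integrable_sq hf2.integrable_sq
    (fun x => trunc_sq_le K.cast_nonneg f x)

lemma IsMarkovChain.abs_covariance_le (hX : IsMarkovChain P π X μ)
    (h : GeomBound P π A s) (hπ : P.Invariant π) {f : S → ℝ} (hf : Measurable f)
    (hf2 : MemLp f 2 π) (k n : ℕ) :
    |cov[fun ω => f (X k ω), fun ω => f (X (k + n) ω); μ]|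
      ≤ s ^ n * ((2 * A + 2) * ∫ x, f x ^ 2 ∂π) :=
  le_of_tendsto (hX.tendsto_covariance_trunc hπ hf hf2 k (k + n)).abs
    (Eventually.of_forall fun K => hX.abs_covariance_trunc_le h hπ hf hf2 k n K)

/-! ### The asymptotic variance -/

lemma autocov_eq (P : Kernel S S) [IsMarkovKernel P] (π : Measure S) (f : S → ℝ) (i : ℕ) :
    autocov P π f i = cov[fun x : ℕ → S => f (x 0), fun x : ℕ → S => f (x (0 + i));
      chainMeasure P π] := by
  rw [zero_add]; rfl

instance (P : Kernel S S) [IsMarkovKernel P] (π : Measure S) [IsProbabilityMeasure π] :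
    IsProbabilityMeasure (chainMeasure P π) := by
  unfold chainMeasure; infer_instance

lemma variance_eq_autocov_zero (P : Kernel S S) [IsMarkovKernel P] (π : Measure S) {f : S → ℝ}
    (hf : Measurable f) :
    Var[fun x : ℕ → S => f (x 0); chainMeasure P π] = autocov P π f 0 :=
  (covariance_self (X := fun x : ℕ → S => f (x 0))
    (Measurable.aemeasurable (by fun_prop))).symm

lemma GeomBound.summable_autocov (h : GeomBound P π A s) (hπ : P.Invariant π) {f : S → ℝ}
    (hf : Measurable f) (hf2 : MemLp f 2 π) :
    Summable (fun i : ℕ => autocov P π f (i + 1)) := by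
  refine Summable.of_norm_bounded (h.summable_pow_mul ((2 * A + 2) * ∫ x, f x ^ 2 ∂π)) (fun i => ?_)
  rw [autocov_eq]
  exact (isMarkovChain_chainMeasure P π).abs_covariance_le h hπ hf hf2 0 (i + 1)

lemma GeomBound.tendsto_asympVar_trunc (h : GeomBound P π A s) (hπ : P.Invariant π) {f : S → ℝ}
    (hf : Measurable f) (hf2 : MemLp f 2 π) :
    Tendsto (fun K : ℕ => asympVar P π (trunc (K : ℝ) f)) atTop (𝓝 (asympVar P π f)) := by
  have hX := isMarkovChain_chainMeasure P π
  unfold asympVar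
  refine Tendsto.add ?_ (Tendsto.const_mul 2 ?_)
  · simp_rw [variance_eq_autocov_zero P π hf, variance_eq_autocov_zero P π (measurable_trunc _ hf)]
    exact hX.tendsto_covariance_trunc hπ hf hf2 0 0
  · refine tendsto_tsum_of_dominated_convergence
      (h.summable_pow_mul ((2 * A + 2) * ∫ x, f x ^ 2 ∂π)) (fun i => ?_)
      (Eventually.of_forall fun K i => ?_)
    · exact hX.tendsto_covariance_trunc hπ hf hf2 0 (i + 1)
    · rw [autocov_eq]
      exact hX.abs_covariance_trunc_le h hπ hf hf2 0 (i + 1) K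

/-- For bounded `f` the series of autocovariances can be summed through Poisson's equation. -/
lemma GeomBound.asympVar_eq (h : GeomBound P π A s) (hπ : P.Invariant π) {f : S → ℝ}
    (hf : Measurable f) {K : ℝ} (hK : ∀ x, |f x| ≤ K) {g : S → ℝ}
    (hg : g = fun x => f x - ∫ y, f y ∂π) :
    asympVar P π f = ∫ x, g x ^ 2 ∂π + 2 * ∫ x, g x * (poissonSol P g x - g x) ∂π := by
  have hX := isMarkovChain_chainMeasure P π
  have hgm : Measurable g := by rw [hg]; exact hf.sub_const _
  have hgb : ∀ x, |g x| ≤ K + |∫ y, f y ∂π| := fun x => by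
    rw [hg]; exact (abs_sub _ _).trans (by gcongr; exact hK x)
  have hg0 : ∫ x, g x ∂π = 0 := by
    rw [hg, integral_sub (integrable_of_norm_le _ hf hK) (integrable_const _)]; simp
  have hmean : ∀ i : ℕ, ∫ x : ℕ → S, f (x i) ∂(chainMeasure P π) = ∫ y, f y ∂π := fun i =>
    hX.integral_comp_eq hπ i hf
  have hcov : ∀ i, autocov P π f i = ∫ x, g x * transOp (P ^ i) g x ∂π := by
    intro i
    rw [autocov_eq, covariance, hmean, hmean]
    have := hX.integral_mul 0 i hgm hgb hgm hgb
    rw [hX.integral_comp_eq hπ 0 (φ := fun x => g x * transOp (P ^ i) g x)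
      (hgm.mul (measurable_transOp _ hgm))] at this
    rw [← this, hg]
  have hvar : Var[fun x : ℕ → S => f (x 0); chainMeasure P π] = ∫ x, g x ^ 2 ∂π := by
    rw [variance_eq_autocov_zero P π hf, hcov, transOp_pow_zero P hgm]
    simp_rw [sq]
  have hsum := h.hasSum_integral_mul_transOp hgm hgb hg0
  obtain ⟨L, hL⟩ := h.exists_abs_poissonSol_le hgm hgb hg0
  have hgi : Integrable g π := integrable_of_norm_le _ hgm hgb
  have hsplit : ∫ x, g x * (poissonSol P g x - g x) ∂π
      = ∫ x, g x * poissonSol P g x ∂π - ∫ x, g x ^ 2 ∂π := by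
    rw [← integral_sub]
    · congr 1; ext x; ring
    · exact hgi.mul_bdd (measurable_poissonSol P hgm).aestronglyMeasurable (ae_of_all _ hL)
    · simp_rw [sq]
      exact hgi.mul_bdd hgm.aestronglyMeasurable (ae_of_all _ hgb)
  rw [asympVar, hvar, hsplit, ← hsum.tsum_eq, hsum.summable.tsum_eq_zero_add,
    transOp_pow_zero P hgm]
  simp_rw [hcov, sq]
  ring

/-! ### Variance of additive functionals -/

/-- The exponent is `|i - j|`, written so that the subtraction does not truncate. -/
lemma sum_pow_dist_le {s : ℝ} (hs : 0 < s) (hs1 : s < 1) {i n : ℕ} (hi : i ≤ n) :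
    ∑ j ∈ Finset.range n, s ^ (max i j - min i j) ≤ 2 * (1 - s)⁻¹ := by
  have hgeo : ∀ m : ℕ, ∑ k ∈ Finset.range m, s ^ k ≤ (1 - s)⁻¹ := fun m => by
    rw [← tsum_geometric_of_lt_one hs.le hs1]
    exact (summable_geometric_of_lt_one hs.le hs1).sum_le_tsum _ (fun _ _ => by positivity)
  rw [← Finset.sum_range_add_sum_Ico _ hi, two_mul]
  refine add_le_add ?_ ?_
  · calc ∑ j ∈ Finset.range i, s ^ (max i j - min i j)
        ≤ ∑ j ∈ Finset.range (i + 1), s ^ (i - j) := by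
          rw [Finset.sum_range_succ]
          have : ∑ j ∈ Finset.range i, s ^ (max i j - min i j)
              = ∑ j ∈ Finset.range i, s ^ (i - j) :=
            Finset.sum_congr rfl fun j hj => by
              rw [max_eq_left (Finset.mem_range.1 hj).le, min_eq_right (Finset.mem_range.1 hj).le]
          rw [this]
          have : 0 < s ^ (i - i) := by positivity
          linarith
      _ = ∑ k ∈ Finset.range (i + 1), s ^ k := Finset.sum_flip (fun k => s ^ k)
      _ ≤ _ := hgeo _
  · rw [Finset.sum_Ico_eq_sum_range]
    simpa using hgeo (n - i)

lemma IsMarkovChain.variance_sum_le (hX : IsMarkovChain P π X μ)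
    (h : GeomBound P π A s) (hπ : P.Invariant π) {f : S → ℝ} (hf : Measurable f)
    (hf2 : MemLp f 2 π) (n : ℕ) :
    Var[fun ω => ∑ j ∈ Finset.range n, f (X (j + 1) ω); μ]
      ≤ n * (2 * (1 - s)⁻¹ * ((2 * A + 2) * ∫ x, f x ^ 2 ∂π)) := by
  have hA := h.1
  have hc : 0 ≤ (2 * A + 2) * ∫ x, f x ^ 2 ∂π :=
    mul_nonneg (by linarith) (integral_nonneg fun _ => sq_nonneg _)
  rw [variance_fun_sum' fun i _ => hX.memLp_comp hπ (i + 1) hf2]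
  have hcov : ∀ i j : ℕ, cov[fun ω => f (X (i + 1) ω), fun ω => f (X (j + 1) ω); μ]
      ≤ s ^ (max i j - min i j) * ((2 * A + 2) * ∫ x, f x ^ 2 ∂π) := by
    intro i j
    rcases le_total i j with hij | hij
    · obtain ⟨d, rfl⟩ := Nat.exists_eq_add_of_le hij
      have := hX.abs_covariance_le h hπ hf hf2 (i + 1) d
      rw [max_eq_right hij, min_eq_left hij, Nat.add_sub_cancel_left, add_right_comm i d 1]
      exact (le_abs_self _).trans this
    · obtain ⟨d, rfl⟩ := Nat.exists_eq_add_of_le hij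
      have := hX.abs_covariance_le h hπ hf hf2 (j + 1) d
      rw [covariance_comm, max_eq_left hij, min_eq_right hij, Nat.add_sub_cancel_left,
        add_right_comm j d 1]
      exact (le_abs_self _).trans this
  calc _ ≤ ∑ i ∈ Finset.range n, ∑ j ∈ Finset.range n,
        s ^ (max i j - min i j) * ((2 * A + 2) * ∫ x, f x ^ 2 ∂π) :=
        Finset.sum_le_sum fun i _ => Finset.sum_le_sum fun j _ => hcov i j
    _ ≤ ∑ i ∈ Finset.range n, 2 * (1 - s)⁻¹ * ((2 * A + 2) * ∫ x, f x ^ 2 ∂π) := by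
        refine Finset.sum_le_sum fun i hi => ?_
        rw [← Finset.sum_mul]
        exact mul_le_mul_of_nonneg_right
          (sum_pow_dist_le h.2.1 h.2.2.1 (Finset.mem_range.1 hi).le) hc
    _ = _ := by rw [Finset.sum_const, Finset.card_range, nsmul_eq_mul]

end Covariance

/-! ### The limit for the stationary chain -/

section Stationary

lemma norm_exp_ofReal_mul_I_sub_le (a b : ℝ) :
    ‖Complex.exp (a * Complex.I) - Complex.exp (b * Complex.I)‖ ≤ |a - b| := by
  have e : Complex.exp (a * Complex.I) - Complex.exp (b * Complex.I)
      = Complex.exp (b * Complex.I) * (Complex.exp (Complex.I * (a - b : ℝ)) - 1) := by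
    rw [mul_sub, ← Complex.exp_add, mul_one]
    congr 2
    push_cast
    ring
  rw [e, norm_mul, Complex.norm_exp_ofReal_mul_I, one_mul]
  exact Real.norm_exp_I_mul_ofReal_sub_one_le

lemma integral_abs_sub_le_sqrt_variance {Ω : Type*} [MeasurableSpace Ω] {μ : Measure Ω}
    [IsProbabilityMeasure μ] {Y : Ω → ℝ} (hY : MemLp Y 2 μ) :
    ∫ ω, |Y ω - ∫ ω', Y ω' ∂μ| ∂μ ≤ √(Var[Y; μ]) := by
  have hZ : MemLp (fun ω => |Y ω - ∫ ω', Y ω' ∂μ|) 2 μ := (hY.sub (memLp_const _)).abs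
  have h := variance_nonneg (fun ω => |Y ω - ∫ ω', Y ω' ∂μ|) μ
  rw [variance_eq_sub hZ] at h
  refine Real.le_sqrt_of_sq_le ?_
  rw [variance_eq_integral hY.aemeasurable]
  have e : ∫ ω, ((fun ω => |Y ω - ∫ ω', Y ω' ∂μ|) ^ 2) ω ∂μ
      = ∫ ω, (Y ω - ∫ ω', Y ω' ∂μ) ^ 2 ∂μ := by
    simp [sq_abs]
  rw [e] at h
  linarith

variable {S : Type*} [MeasurableSpace S] {P : Kernel S S} [IsMarkovKernel P] {π : Measure S}
  [IsProbabilityMeasure π] {A s : ℝ}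
  {Ω : Type*} [MeasurableSpace Ω] {μ : Measure Ω} [IsProbabilityMeasure μ] {X : ℕ → Ω → S}

lemma IsMarkovChain.tendsto_integral_exp_of_bounded (hX : IsMarkovChain P π X μ)
    (h : GeomBound P π A s) (hπ : P.Invariant π) {f : S → ℝ} (hf : Measurable f) {K : ℝ}
    (hK : ∀ x, |f x| ≤ K) (u : ℝ) :
    Tendsto (fun n : ℕ => ∫ ω, Complex.exp (((√n)⁻¹ * u *
        ∑ j ∈ Finset.range n, (f (X (j + 1) ω) - ∫ x, f x ∂π) : ℝ) * Complex.I) ∂μ) atTop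
      (𝓝 (Complex.exp (-(u ^ 2 * asympVar P π f / 2 : ℝ)))) := by
  set g : S → ℝ := fun x => f x - ∫ y, f y ∂π with hg
  have hgm : Measurable g := hf.sub_const _
  have hgb : ∀ x, |g x| ≤ K + |∫ y, f y ∂π| := fun x =>
    (abs_sub _ _).trans (by gcongr; exact hK x)
  have hg0 : ∫ x, g x ∂π = 0 := by
    rw [hg, integral_sub (integrable_of_norm_le _ hf hK) (integrable_const _)]; simp
  refine (h.tendsto_integral_tiltOp hπ hgm hgb hg0 (h.asympVar_eq hπ hf hK hg) π u).congr
    fun n => ?_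
  have := hX.integral_exp_mul hgm ((√n)⁻¹ * u) 0 n (measurable_const (a := (1 : ℂ))) (K := 1)
    (fun _ => by simp)
  rw [hX.integral_comp_eq hπ 0 (measurable_tiltOp_iterate P hgm _ measurable_const n)] at this
  rw [← this]
  simp [hg]

/-- Replacing `f` by its truncation changes the characteristic functions little, uniformly in
`n`. -/
lemma IsMarkovChain.dist_integral_exp_trunc_le (hX : IsMarkovChain P π X μ)
    (h : GeomBound P π A s) (hπ : P.Invariant π) {f : S → ℝ} (hf : Measurable f)
    (hf2 : MemLp f 2 π) (u : ℝ) (K n : ℕ) :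
    dist (∫ ω, Complex.exp (((√n)⁻¹ * u *
        ∑ j ∈ Finset.range n, (f (X (j + 1) ω) - ∫ x, f x ∂π) : ℝ) * Complex.I) ∂μ)
      (∫ ω, Complex.exp (((√n)⁻¹ * u * ∑ j ∈ Finset.range n,
        (trunc (K : ℝ) f (X (j + 1) ω) - ∫ x, trunc (K : ℝ) f x ∂π) : ℝ) * Complex.I) ∂μ)
      ≤ |u| * √(2 * (1 - s)⁻¹ * ((2 * A + 2) * ∫ x, (f x - trunc (K : ℝ) f x) ^ 2 ∂π)) := by
  have hXm := hX.measurable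
  have htm := measurable_trunc (K : ℝ) hf
  have ht2 : MemLp (trunc (K : ℝ) f) 2 π := memLp_trunc hf K.cast_nonneg
  set r : S → ℝ := fun x => f x - trunc (K : ℝ) f x with hr
  have hrm : Measurable r := hf.sub htm
  have hr2 : MemLp r 2 π := hf2.sub ht2
  have hr0 : ∫ x, r x ∂π = ∫ x, f x ∂π - ∫ x, trunc (K : ℝ) f x ∂π :=
    integral_sub (hf2.integrable one_le_two) (ht2.integrable one_le_two)
  set Y : Ω → ℝ := fun ω => ∑ j ∈ Finset.range n, r (X (j + 1) ω) with hY
  have hY2 : MemLp Y 2 μ := memLp_finsetSum _ fun j _ => hX.memLp_comp hπ (j + 1) hr2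
  have hYmean : ∫ ω, Y ω ∂μ = n * ∫ x, r x ∂π := by
    rw [hY, integral_finsetSum _ fun j _ =>
      (hX.memLp_comp hπ (j + 1) hr2).integrable one_le_two]
    simp [hX.integral_comp_eq hπ _ hrm]
  have hint : ∀ c : Ω → ℝ, Measurable c →
      Integrable (fun ω => Complex.exp ((c ω : ℝ) * Complex.I)) μ := fun c hc =>
    integrable_of_norm_le _ (by fun_prop) (K := 1)
      (fun ω => (Complex.norm_exp_ofReal_mul_I _).le)
  rw [dist_eq_norm, ← integral_sub (hint _ (by fun_prop)) (hint _ (by fun_prop))]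
  have hpt : ∀ ω, ‖Complex.exp (((√n)⁻¹ * u *
        ∑ j ∈ Finset.range n, (f (X (j + 1) ω) - ∫ x, f x ∂π) : ℝ) * Complex.I)
      - Complex.exp (((√n)⁻¹ * u * ∑ j ∈ Finset.range n,
        (trunc (K : ℝ) f (X (j + 1) ω) - ∫ x, trunc (K : ℝ) f x ∂π) : ℝ) * Complex.I)‖
      ≤ (√n)⁻¹ * |u| * |Y ω - ∫ ω', Y ω' ∂μ| := by
    intro ω
    refine (norm_exp_ofReal_mul_I_sub_le _ _).trans (le_of_eq ?_)
    rw [← mul_sub, abs_mul, abs_mul, abs_of_nonneg (inv_nonneg.2 (Real.sqrt_nonneg _)), hYmean,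
      hr0, hY]
    congr 2
    simp only [hr, Finset.sum_sub_distrib, Finset.sum_const, Finset.card_range, nsmul_eq_mul]
    ring
  have hYi : Integrable (fun ω => |Y ω - ∫ ω', Y ω' ∂μ|) μ :=
    ((hY2.integrable one_le_two).sub (integrable_const _)).abs
  refine (norm_integral_le_of_norm_le (hYi.const_mul _) (ae_of_all _ hpt)).trans ?_
  rw [integral_const_mul]
  have hvar := hX.variance_sum_le h hπ hrm hr2 n
  have hsqrt := (integral_abs_sub_le_sqrt_variance hY2).trans (Real.sqrt_le_sqrt hvar)
  rw [Real.sqrt_mul (Nat.cast_nonneg n)] at hsqrt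
  refine (mul_le_mul_of_nonneg_left hsqrt (by positivity)).trans ?_
  have hle : (√(n : ℝ))⁻¹ * √n ≤ 1 := inv_mul_le_one
  calc _ = ((√(n : ℝ))⁻¹ * √n) *
        (|u| * √(2 * (1 - s)⁻¹ * ((2 * A + 2) * ∫ x, r x ^ 2 ∂π))) := by ring
    _ ≤ 1 * (|u| * √(2 * (1 - s)⁻¹ * ((2 * A + 2) * ∫ x, r x ^ 2 ∂π))) :=
        mul_le_mul_of_nonneg_right hle (by positivity)
    _ = _ := one_mul _

/-- The central limit theorem for the stationary chain, in terms of characteristic functions. -/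
theorem IsMarkovChain.tendsto_integral_exp (hX : IsMarkovChain P π X μ)
    (h : GeomBound P π A s) (hπ : P.Invariant π) {f : S → ℝ} (hf : Measurable f)
    (hf2 : MemLp f 2 π) (u : ℝ) :
    Tendsto (fun n : ℕ => ∫ ω, Complex.exp (((√n)⁻¹ * u *
        ∑ j ∈ Finset.range n, (f (X (j + 1) ω) - ∫ x, f x ∂π) : ℝ) * Complex.I) ∂μ) atTop
      (𝓝 (Complex.exp (-(u ^ 2 * asympVar P π f / 2 : ℝ)))) := by
  have hlim : Tendsto (fun K : ℕ =>
      |u| * √(2 * (1 - s)⁻¹ * ((2 * A + 2) * ∫ x, (f x - trunc (K : ℝ) f x) ^ 2 ∂π)))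
      atTop (𝓝 0) := by
    have := ((((tendsto_integral_sub_trunc_sq hf hf2.integrable_sq).const_mul
      (2 * A + 2)).const_mul (2 * (1 - s)⁻¹)).sqrt).const_mul |u|
    simpa using this
  have hunif : TendstoUniformly (fun (K : ℕ) (n : ℕ) => ∫ ω, Complex.exp (((√n)⁻¹ * u *
      ∑ j ∈ Finset.range n,
        (trunc (K : ℝ) f (X (j + 1) ω) - ∫ x, trunc (K : ℝ) f x ∂π) : ℝ) * Complex.I) ∂μ)
      (fun n : ℕ => ∫ ω, Complex.exp (((√n)⁻¹ * u *
        ∑ j ∈ Finset.range n, (f (X (j + 1) ω) - ∫ x, f x ∂π) : ℝ) * Complex.I) ∂μ) atTop := by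
    rw [Metric.tendstoUniformly_iff]
    intro ε hε
    filter_upwards [hlim.eventually (gt_mem_nhds hε)] with K hK n
    exact (hX.dist_integral_exp_trunc_le h hπ hf hf2 u K n).trans_lt hK
  -- The limits `K → ∞` and `n → ∞` are interchanged by uniformity in `n`.
  refine hunif.tendsto_of_eventually_tendsto (Eventually.of_forall fun K =>
    hX.tendsto_integral_exp_of_bounded h hπ (measurable_trunc _ hf)
      (abs_trunc_le K.cast_nonneg f) u) ?_
  have hc : Continuous (fun v : ℝ => Complex.exp (-(u ^ 2 * v / 2 : ℝ))) := by fun_prop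
  exact (hc.tendsto _).comp (h.tendsto_asympVar_trunc hπ hf hf2)

/-- A characteristic function has modulus at most `1`, and so has its limit `exp (-σ²/2)`. -/
lemma GeomBound.asympVar_nonneg (h : GeomBound P π A s) (hπ : P.Invariant π) {f : S → ℝ}
    (hf : Measurable f) (hf2 : MemLp f 2 π) : 0 ≤ asympVar P π f := by
  have := ((isMarkovChain_chainMeasure P π).tendsto_integral_exp h hπ hf hf2 1).norm
  have hle := le_of_tendsto (b := 1) this (Eventually.of_forall fun n =>
    (norm_integral_le_of_norm_le_const (C := 1)
      (ae_of_all _ fun ω => (Complex.norm_exp_ofReal_mul_I _).le)).trans (by simp))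
  rw [← Complex.ofReal_neg, Complex.norm_exp, Complex.ofReal_re, Real.exp_le_one_iff] at hle
  linarith

end Stationary

/-! ### Arbitrary initial distributions -/

section Initial

variable {S : Type*} [MeasurableSpace S] {P : Kernel S S} [IsMarkovKernel P] {lam : Measure S}
  {Ω : Type*} [MeasurableSpace Ω] {μ : Measure Ω} [IsProbabilityMeasure μ] {X : ℕ → Ω → S}

/-- The first `k` steps do not contribute to the limit. -/
lemma IsMarkovChain.tendsto_integral_exp_sub_tiltOp (hX : IsMarkovChain P lam X μ) {g : S → ℝ}
    (hg : Measurable g) (u : ℝ) (k : ℕ) :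
    Tendsto (fun n : ℕ => ∫ ω, Complex.exp (((√n)⁻¹ * u *
        ∑ j ∈ Finset.range n, g (X (j + 1) ω) : ℝ) * Complex.I) ∂μ
      - ∫ ω, (tiltOp P g ((√n)⁻¹ * u))^[n - k] (fun _ => 1) (X k ω) ∂μ) atTop (𝓝 0) := by
  have hXm := hX.measurable
  have hθ : Tendsto (fun n : ℕ => (√n)⁻¹ * u) atTop (𝓝 0) := by
    rw [← zero_mul u]
    exact .mul_const u (tendsto_inv_atTop_zero.comp <| Real.tendsto_sqrt_atTop.comp <|
      tendsto_natCast_atTop_atTop)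
  -- Dropping the first `k` terms multiplies the exponential by a factor tending to `1`.
  have hhead : Tendsto (fun n : ℕ => ∫ ω, ‖Complex.exp (((√n)⁻¹ * u *
      ∑ j ∈ Finset.range k, g (X (j + 1) ω) : ℝ) * Complex.I) - 1‖ ∂μ) atTop (𝓝 0) := by
    have := tendsto_integral_of_dominated_convergence (μ := μ)
      (F := fun (n : ℕ) ω => ‖Complex.exp (((√n)⁻¹ * u *
        ∑ j ∈ Finset.range k, g (X (j + 1) ω) : ℝ) * Complex.I) - 1‖) (f := fun _ => 0)
      (fun _ => 2) (fun n => (Measurable.aestronglyMeasurable (by fun_prop)))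
      (integrable_const _) (fun n => ae_of_all _ fun ω => by
        rw [norm_norm]
        refine (norm_sub_le _ _).trans ?_
        rw [Complex.norm_exp_ofReal_mul_I, norm_one]; norm_num)
      (ae_of_all _ fun ω => ?_)
    · simpa using this
    · have hc : Continuous (fun θ : ℝ => ‖Complex.exp ((θ *
        ∑ j ∈ Finset.range k, g (X (j + 1) ω) : ℝ) * Complex.I) - 1‖) := by fun_prop
      have := (hc.tendsto 0).comp hθ
      simpa [Function.comp_def] using this
  rw [tendsto_zero_iff_norm_tendsto_zero]
  refine squeeze_zero' (Eventually.of_forall fun _ => norm_nonneg _) ?_ hhead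
  filter_upwards [eventually_ge_atTop k] with n hn
  set θ := (√n)⁻¹ * u
  have hstart := hX.integral_exp_mul hg θ k (n - k) (measurable_const (a := (1 : ℂ))) (K := 1)
    (fun _ => by simp)
  simp only [mul_one] at hstart
  have hint : ∀ c : Ω → ℝ, Measurable c →
      Integrable (fun ω => Complex.exp ((c ω : ℝ) * Complex.I)) μ := fun c hc =>
    integrable_of_norm_le _ (by fun_prop) (K := 1)
      (fun ω => (Complex.norm_exp_ofReal_mul_I _).le)
  rw [← hstart, ← integral_sub (hint _ (by fun_prop)) (hint _ (by fun_prop))]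
  refine (norm_integral_le_integral_norm _).trans (le_of_eq (integral_congr_ae
    (ae_of_all _ fun ω => ?_)))
  have hsplit : ∑ j ∈ Finset.range n, g (X (j + 1) ω)
      = ∑ j ∈ Finset.range k, g (X (j + 1) ω)
        + ∑ j ∈ Finset.range (n - k), g (X (k + j + 1) ω) := by
    rw [← Finset.sum_range_add_sum_Ico _ hn, Finset.sum_Ico_eq_sum_range]
  simp only
  rw [hsplit, mul_add, Complex.ofReal_add, add_mul, Complex.exp_add, ← sub_one_mul, norm_mul,
    Complex.norm_exp_ofReal_mul_I, mul_one]

variable {π : Measure S} [IsProbabilityMeasure π] {A s : ℝ}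
  {Ω' : Type*} [MeasurableSpace Ω'] {ν : Measure Ω'} [IsProbabilityMeasure ν] {Y : ℕ → Ω' → S}

lemma IsMarkovChain.norm_integral_comp_sub_le (hX : IsMarkovChain P lam X μ)
    (h : GeomBound P π A s) {φ : S → ℂ} (hφ : Measurable φ) (hφ1 : ∀ x, ‖φ x‖ ≤ 1) (k : ℕ) :
    ‖∫ ω, φ (X k ω) ∂μ - ∫ x, φ x ∂π‖ ≤ 4 * A * (s ^ 2) ^ k := by
  have e := hX.integral_mul 0 k (measurable_const (a := (1 : ℂ))) (C := 1) (fun _ => by simp) hφ hφ1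
  simp only [one_mul, zero_add] at e
  have hi : Integrable (fun ω => transOp (P ^ k) φ (X 0 ω)) μ :=
    integrable_of_norm_le _ ((measurable_transOp _ hφ).comp (hX.measurable 0)) (K := 1)
      (fun ω => norm_transOp_le _ hφ1 _)
  have e2 : ∫ ω, transOp (P ^ k) φ (X 0 ω) ∂μ - ∫ x, φ x ∂π
      = ∫ ω, (transOp (P ^ k) φ (X 0 ω) - ∫ x, φ x ∂π) ∂μ := by
    rw [integral_sub hi (integrable_const _)]; simp
  rw [e, e2]
  have := norm_integral_le_of_norm_le_const (μ := μ) (C := 4 * A * (s ^ 2) ^ k)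
    (f := fun ω => transOp (P ^ k) φ (X 0 ω) - ∫ x, φ x ∂π) (ae_of_all _ fun ω => by
      refine (norm_integral_sub_le (h.2.2.2 k (X 0 ω)) hφ hφ1).trans (le_of_eq ?_)
      rw [pow_right_comm]; ring)
  simpa using this

/-- The limit of the characteristic functions does not depend on the initial distribution. -/
lemma IsMarkovChain.tendsto_integral_exp_sub (hX : IsMarkovChain P lam X μ)
    (hY : IsMarkovChain P π Y ν) (h : GeomBound P π A s) (hπ : P.Invariant π) {g : S → ℝ}
    (hg : Measurable g) (u : ℝ) :
    Tendsto (fun n : ℕ => ∫ ω, Complex.exp (((√n)⁻¹ * u *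
        ∑ j ∈ Finset.range n, g (X (j + 1) ω) : ℝ) * Complex.I) ∂μ
      - ∫ ω, Complex.exp (((√n)⁻¹ * u *
        ∑ j ∈ Finset.range n, g (Y (j + 1) ω) : ℝ) * Complex.I) ∂ν) atTop (𝓝 0) := by
  rw [Metric.tendsto_nhds]
  intro ε hε
  have hk : Tendsto (fun k : ℕ => 4 * A * (s ^ 2) ^ k) atTop (𝓝 0) :=
    (h.summable (4 * A)).tendsto_atTop_zero
  -- `k` is fixed first, so that the laws at time `k` are close; then `n` tends to infinity.
  obtain ⟨k, hk⟩ := (hk.eventually (gt_mem_nhds (show 0 < ε / 3 by positivity))).exists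
  have hXk := Metric.tendsto_nhds.1 (hX.tendsto_integral_exp_sub_tiltOp hg u k) (ε / 3)
    (by positivity)
  have hYk := Metric.tendsto_nhds.1 (hY.tendsto_integral_exp_sub_tiltOp hg u k) (ε / 3)
    (by positivity)
  filter_upwards [hXk, hYk] with n hXn hYn
  have hm := measurable_tiltOp_iterate P hg ((√n)⁻¹ * u) (measurable_const (a := (1 : ℂ))) (n - k)
  have hmid := hX.norm_integral_comp_sub_le h hm
    (norm_tiltOp_iterate_le P g ((√n)⁻¹ * u) (fun _ => by simp) (n - k)) k
  rw [← hY.integral_comp_eq hπ k hm] at hmid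
  rw [dist_zero_right] at hXn hYn ⊢
  set a := ∫ ω, Complex.exp (((√n)⁻¹ * u *
        ∑ j ∈ Finset.range n, g (X (j + 1) ω) : ℝ) * Complex.I) ∂μ
  set b := ∫ ω, Complex.exp (((√n)⁻¹ * u *
        ∑ j ∈ Finset.range n, g (Y (j + 1) ω) : ℝ) * Complex.I) ∂ν
  set a' := ∫ ω, (tiltOp P g ((√n)⁻¹ * u))^[n - k] (fun _ => 1) (X k ω) ∂μ
  set b' := ∫ ω, (tiltOp P g ((√n)⁻¹ * u))^[n - k] (fun _ => 1) (Y k ω) ∂ν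
  have e : a - b = (a - a') + (a' - b') - (b - b') := by ring
  rw [e]
  calc ‖(a - a') + (a' - b') - (b - b')‖ ≤ ‖a - a'‖ + ‖a' - b'‖ + ‖b - b'‖ :=
        (norm_sub_le _ _).trans (by gcongr; exact norm_add_le _ _)
    _ < ε := by linarith

end Initial

lemma sqrt_mul_ergodicAverage_sub {S Ω : Type*} (f : S → ℝ) (X : ℕ → Ω → S) (m : ℝ) (n : ℕ)
    (ω : Ω) :
    √n * (ergodicAverage f X n ω - m) = (√n)⁻¹ * ∑ j ∈ Finset.range n, (f (X (j + 1) ω) - m) := by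
  rcases Nat.eq_zero_or_pos n with rfl | hn
  · simp
  · have hn0 : (0 : ℝ) < n := by exact_mod_cast hn
    have hs : √(n : ℝ) ≠ 0 := (Real.sqrt_pos.2 hn0).ne'
    have hsum : ∑ i ∈ Finset.Icc 1 n, f (X i ω) = ∑ j ∈ Finset.range n, f (X (j + 1) ω) := by
      rw [Finset.range_eq_Ico, Finset.sum_Ico_add' (fun i => f (X i ω)) 0 n 1]
      rfl
    rw [ergodicAverage, hsum, Finset.sum_sub_distrib, Finset.sum_const, Finset.card_range,
      nsmul_eq_mul]
    field_simp
    rw [Real.sq_sqrt hn0.le]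

end MarkovCLT

theorem mainTheorem6 {S : Type*} [MeasurableSpace S]
    (P : Kernel S S) [IsMarkovKernel P]
    (π : Measure S) [IsProbabilityMeasure π]
    (hπ : P.Invariant π) (hP : MarkovCLT.UniformlyErgodic P π)
    (f : S → ℝ) (hf : Measurable f) (hf2 : Integrable (fun x => f x ^ 2) π) :
    Summable (fun i : ℕ => MarkovCLT.autocov P π f (i + 1)) ∧
    0 ≤ MarkovCLT.asympVar P π f ∧
    ∀ (lam : Measure S) [IsProbabilityMeasure lam]
      {Ω : Type*} [MeasurableSpace Ω] (μ : Measure Ω) [IsProbabilityMeasure μ]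
      (X : ℕ → Ω → S), MarkovCLT.IsMarkovChain P lam X μ →
      TendstoInDistribution
        (fun (n : ℕ) (ω : Ω) =>
          Real.sqrt n * (MarkovCLT.ergodicAverage f X n ω - ∫ x, f x ∂π))
        atTop (id : ℝ → ℝ) (fun _ => μ)
        (gaussianReal 0 (MarkovCLT.asympVar P π f).toNNReal) := by
  obtain ⟨A, s, h⟩ := hP.exists_geomBound
  have hL2 : MemLp f 2 π := (memLp_two_iff_integrable_sq hf.aestronglyMeasurable).2 hf2
  have hσ := h.asympVar_nonneg hπ hf hL2
  refine ⟨h.summable_autocov hπ hf hL2, hσ, ?_⟩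
  intro lam _ Ω _ μ _ X hX
  have hXm := hX.measurable
  simp_rw [MarkovCLT.sqrt_mul_ergodicAverage_sub]
  have hm : ∀ n : ℕ, Measurable fun ω =>
      (√n)⁻¹ * ∑ j ∈ Finset.range n, (f (X (j + 1) ω) - ∫ x, f x ∂π) := fun n => by fun_prop
  refine ⟨fun n => (hm n).aemeasurable, aemeasurable_id, ?_⟩
  refine ProbabilityMeasure.tendsto_iff_tendsto_charFun.2 fun u => ?_
  have hY := MarkovCLT.isMarkovChain_chainMeasure P π
  have hlim := (hX.tendsto_integral_exp_sub hY h hπ (hf.sub_const (∫ x, f x ∂π)) u).add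
    (hY.tendsto_integral_exp h hπ hf hL2 u)
  simp only [sub_add_cancel, zero_add] at hlim
  have hgauss : charFun ((gaussianReal 0 (MarkovCLT.asympVar P π f).toNNReal).map id) u
      = Complex.exp (-(u ^ 2 * MarkovCLT.asympVar P π f / 2 : ℝ)) := by
    rw [Measure.map_id, charFun_gaussianReal, Real.coe_toNNReal _ hσ]
    congr 1
    push_cast
    ring
  simp only [ProbabilityMeasure.coe_mk]
  rw [hgauss]
  refine hlim.congr fun n => ?_
  rw [charFun_apply_real, integral_map (hm n).aemeasurable (by fun_prop)]
  refine integral_congr_ae (ae_of_all _ fun ω => ?_)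
  simp only
  rw [← Complex.ofReal_mul]
  congr 3
  ring
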